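/- Let $n\ge 1$, let $u\in C^2(\mathbb R^n)$ be an even convex function whose Hessian $\nabla^2u(x)$ is positive definite at every $x$, and let $\mu$ be the even log-concave measure with density $d\mu(x)=e^{-u(x)}\,dx$. A compact convex set $K\subset\mathbb R^n$ with non-empty interior is of class $C^2_+$ if $\partial K$ is a $C^2$ hypersurface with strictly positive principal curvatures; $\nu_K$ denotes its Gauss map and $h_K(x)=\sup_{y\in K}\langle x,y\rangle$ its support function. For $K$ of class $C^2_+$, a function $\rho:\partial K\to\mathbb R$ is admissible if for all sufficiently small $|t|$ the function $h_t=h_K+t\,\rho\circ\nu_K^{-1}$ on the unit sphere is the support function of a set $K(\rho,t)$ of class $C^2_+$ (equivalently, $\rho\circ\nu_K^{-1}$ is of class $C^2$ on the sphere). The concavity power $p(\mu,K)$ is the maximal real number $p$ such that $\frac{d^2}{dt^2}\mu\bigl(K(\rho,t)\bigr)^{p}\big|_{t=0}\le 0$ for every admissible $\rho$. Suppose that $\mu$ satisfies the strong dimensional Brunn--Minkowski condition $$\frac{\mu(K)}{\int_{\partial K}h_K(\nu_K)\,e^{-u}\,d\mathcal H^{n-1}}\le p(\mu,K)\qquad\text{for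 every origin-symmetric }K\text{ of class }C^2_+ .$$ Then $\mu$ satisfies the dimensional Brunn--Minkowski inequality: for all non-empty origin-symmetric convex sets $K,L\subset\mathbb R^n$ and all $t\in[0,1]$, $$\mu\bigl((1-t)K+tL\bigr)^{1/n}\ge(1-t)\,\mu(K)^{1/n}+t\,\mu(L)^{1/n}.$$ -/

import Mathlib

open MeasureTheory Set Filter Topology
open scoped Pointwise

noncomputable section

namespace DimBM

variable {n : ℕ}

/-- `K` is of class `C²₊`: a compact convex set with non-empty interior whose boundary is a `C²`
hypersurface with strictly positive principal curvatures. Near each boundary point `K` is a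
sublevel set `{g ≤ 0}` of a `C²` function `g` with `∇g ≠ 0`; the outer normal is `∇g / |∇g|`, the
second fundamental form is the restriction of `∇²g / |∇g|` to the tangent space `ker dg`, and
strict positivity of the principal curvatures is positive definiteness of that form. -/
structure IsC2Plus (K : Set (EuclideanSpace ℝ (Fin n))) : Prop where
  isCompact : IsCompact K
  convex : Convex ℝ K
  nonempty_interior : (interior K).Nonempty
  boundary : ∀ x ∈ frontier K, ∃ g : EuclideanSpace ℝ (Fin n) → ℝ,
    ContDiffAt ℝ 2 g x ∧ (∀ᶠ y in 𝓝 x, y ∈ K ↔ g y ≤ 0) ∧ fderiv ℝ g x ≠ 0 ∧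
      ∀ v, v ≠ 0 → fderiv ℝ g x v = 0 → 0 < fderiv ℝ (fderiv ℝ g) x v v

/-- Origin-symmetric sets. -/
def IsOriginSymmetric (K : Set (EuclideanSpace ℝ (Fin n))) : Prop :=
  ∀ x ∈ K, -x ∈ K

/-- The support function `h_K(x) = sup_{y ∈ K} ⟨x, y⟩`. -/
def supportFun (K : Set (EuclideanSpace ℝ (Fin n))) (x : EuclideanSpace ℝ (Fin n)) : ℝ :=
  sSup ((fun y => inner ℝ x y) '' K)

/-- The Gauss map `ν_K`: the outer unit normal of `K` at a boundary point (it is unique if `K` is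
of class `C²₊`). -/
def gaussMap (K : Set (EuclideanSpace ℝ (Fin n))) (x : EuclideanSpace ℝ (Fin n)) :
    EuclideanSpace ℝ (Fin n) :=
  Classical.epsilon fun v => ‖v‖ = 1 ∧ ∀ y ∈ K, inner ℝ v y ≤ inner ℝ v x

/-- The inverse `ν_K⁻¹ : 𝕊ⁿ⁻¹ → ∂K` of the Gauss map. -/
def gaussMapInv (K : Set (EuclideanSpace ℝ (Fin n))) :
    EuclideanSpace ℝ (Fin n) → EuclideanSpace ℝ (Fin n) :=
  Function.invFunOn (gaussMap K) (frontier K)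

/-- `h_t = h_K + t ρ(ν_K⁻¹)` on the unit sphere. Only the values of `ρ` on `∂K` matter. -/
def perturbedSupport (K : Set (EuclideanSpace ℝ (Fin n))) (ρ : EuclideanSpace ℝ (Fin n) → ℝ)
    (t : ℝ) (θ : EuclideanSpace ℝ (Fin n)) : ℝ :=
  supportFun K θ + t * ρ (gaussMapInv K θ)

/-- The perturbation `K(ρ, t)`: the set cut out by the half-spaces `⟨θ, x⟩ ≤ h_t(θ)`. It is the
compact convex set with support function `h_t` whenever `h_t` is a support function. -/
def perturbation (K : Set (EuclideanSpace ℝ (Fin n))) (ρ : EuclideanSpace ℝ (Fin n) → ℝ)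
    (t : ℝ) : Set (EuclideanSpace ℝ (Fin n)) :=
  {x | ∀ θ, ‖θ‖ = 1 → inner ℝ θ x ≤ perturbedSupport K ρ t θ}

/-- Admissible perturbations of a set `K` of class `C²₊`: for all small `|t|` the function `h_t`
is the support function of a set of class `C²₊`. As a set of class `C²₊` is one with a support
function of class `C²` on the sphere and positive radii of curvature, this says exactly that
`ρ ∘ ν_K⁻¹` is of class `C²` on the sphere. -/
def IsAdmissible (K : Set (EuclideanSpace ℝ (Fin n))) (ρ : EuclideanSpace ℝ (Fin n) → ℝ) : Prop :=
  ∃ ε : ℝ, 0 < ε ∧ ∀ t : ℝ, |t| < ε → ∃ L : Set (EuclideanSpace ℝ (Fin n)),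
    IsC2Plus L ∧ ∀ θ, ‖θ‖ = 1 → supportFun L θ = perturbedSupport K ρ t θ

/-- `F` is twice differentiable at `0` and `F''(0) ≤ 0`. -/
def SecondDerivNonposAtZero (F : ℝ → ℝ) : Prop :=
  (∀ᶠ s in 𝓝 0, DifferentiableAt ℝ F s) ∧ DifferentiableAt ℝ (deriv F) 0 ∧
    deriv (deriv F) 0 ≤ 0

/-- The concavity power `p(μ, K)`: the maximal exponent `p` with
`d²/dt² μ(K(ρ, t))^p ≤ 0` at `t = 0` for every admissible `ρ`. -/
def concavityPower (μ : Measure (EuclideanSpace ℝ (Fin n))) (K : Set (EuclideanSpace ℝ (Fin n))) :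
    ℝ :=
  sSup {p : ℝ | ∀ ρ : EuclideanSpace ℝ (Fin n) → ℝ, IsAdmissible K ρ →
    SecondDerivNonposAtZero fun t => μ.real (perturbation K ρ t) ^ p}

/-- The measure with density `e^{-u}` with respect to the Lebesgue measure. -/
def expMeasure (u : EuclideanSpace ℝ (Fin n) → ℝ) : Measure (EuclideanSpace ℝ (Fin n)) :=
  volume.withDensity fun x => ENNReal.ofReal (Real.exp (-u x))

/-- `∫_{∂K} h_K(ν_K) dμ` for `dμ = e^{-u} dx`, where on `∂K` the density `e^{-u}` is taken with
respect to the `(n-1)`-dimensional Hausdorff measure (normalised so that `n`-dimensional Hausdorff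
measure is Lebesgue measure in each dimension). -/
def boundarySupportIntegral (u : EuclideanSpace ℝ (Fin n) → ℝ)
    (K : Set (EuclideanSpace ℝ (Fin n))) : ℝ :=
  ∫ x in frontier K, supportFun K (gaussMap K x) * Real.exp (-u x) ∂μHE[n - 1]

/-- The strong dimensional Brunn–Minkowski condition for `dμ = e^{-u} dx`:
`μ(K) / ∫_{∂K} h_K(ν_K) dμ ≤ p(μ, K)` for every origin-symmetric `K` of class `C²₊`. -/
def StrongDimBM (u : EuclideanSpace ℝ (Fin n) → ℝ) : Prop :=
  ∀ K : Set (EuclideanSpace ℝ (Fin n)), IsC2Plus K → IsOriginSymmetric K →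
    (expMeasure u).real K / boundarySupportIntegral u K ≤ concavityPower (expMeasure u) K

/-- The dimensional Brunn–Minkowski inequality for `μ`:
`μ((1-t)K + tL)^{1/n} ≥ (1-t) μ(K)^{1/n} + t μ(L)^{1/n}` for all non-empty origin-symmetric convex
sets `K`, `L` and all `t ∈ [0,1]`. -/
def SatisfiesDimBM (μ : Measure (EuclideanSpace ℝ (Fin n))) : Prop :=
  ∀ K L : Set (EuclideanSpace ℝ (Fin n)), K.Nonempty → L.Nonempty → Convex ℝ K → Convex ℝ L →
    IsOriginSymmetric K → IsOriginSymmetric L → ∀ t ∈ Icc (0 : ℝ) 1,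
      ENNReal.ofReal (1 - t) * μ K ^ (1 / (n : ℝ)) + ENNReal.ofReal t * μ L ^ (1 / (n : ℝ))
        ≤ μ ((1 - t) • K + t • L) ^ (1 / (n : ℝ))

end DimBM

end

open MeasureTheory Set Filter Topology
open scoped Pointwise

noncomputable section

namespace DimBM

variable {n : ℕ}

/-! The condition forces p(μ, K) ≥ 1/n for smooth symmetric bodies K, and this infinitesimal
statement is then integrated along Minkowski segments.

The bound on p(μ, K) amounts to ∫_{∂K} h_K(ν_K) e^{-u} ≤ n μ(K), which is `lintegral_frontier_le`.
An even convex u is non-decreasing along rays from the origin, so over a small boundary patch the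
density on the cone is at least its value on the patch, up to a factor close to 1. It remains to
compare h · area of the patch with n times the volume of its cone: the area is controlled by the
volume of a thin shell of the cone (`exists_surface_le_shell`), and the shell by the whole cone
through homogeneity (`volume_coneShell_le`).

Smooth bodies are described by their support functions h (`IsSmoothNorm`). The body is `wulff h`,
its boundary point with normal θ is ∇h(θ), and it is C²₊ because it is locally a sublevel set of the
Legendre transform of h²/2 (`IsSmoothNorm.isC2Plus`). For two such functions, (1-t)h₁ + t h₂ is
again one, and moving t is an admissible perturbation of each intermediate body. The condition
therefore gives (μ^p)'' ≤ 0 at each t ∈ (0,1), for some p above any prescribed q < 1/n; p may depend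
on t, but it can be lowered to q. So μ^q is concave on (0,1), and the limits towards the end points
and q → 1/n give `le_measure_interp_rpow`.

Arbitrary symmetric convex sets with interior are approximated from inside by smooth bodies, built
from ℓᵖ norms (`exists_isSmoothNorm_between`). The interpolated bodies lie in the Minkowski
combination by `wulff_interp_subset`. Sets without interior are null, and there radial monotonicity
of u suffices. -/

/-- The second derivative of `h ^ 2 / 2`. -/
theorem fderiv_fderiv_sq_half {E : Type*} [NormedAddCommGroup E] [NormedSpace ℝ E] {h : E → ℝ}
    {x : E} (hh : ContDiffAt ℝ 2 h x) (v w : E) :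
    fderiv ℝ (fderiv ℝ fun y => h y ^ 2 / 2) x v w =
      h x * fderiv ℝ (fderiv ℝ h) x v w + fderiv ℝ h x v * fderiv ℝ h x w := by
  have h1 : (fderiv ℝ fun y => h y ^ 2 / 2) =ᶠ[𝓝 x] fun y => h y • fderiv ℝ h y := by
    filter_upwards [hh.eventually (by simp)] with y hy
    have hd : HasFDerivAt h (fderiv ℝ h y) y := (hy.differentiableAt (by simp)).hasFDerivAt
    have h2 : HasFDerivAt (fun y => h y ^ 2 / 2) (h y • fderiv ℝ h y) y := by
      simp only [div_eq_mul_inv]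
      refine ((hd.pow 2).mul_const (2⁻¹ : ℝ)).congr_fderiv ?_
      ext z
      simp
      ring
    exact h2.fderiv
  rw [h1.fderiv_eq]
  have hd : HasFDerivAt h (fderiv ℝ h x) x := (hh.differentiableAt (by simp)).hasFDerivAt
  have hd2 : HasFDerivAt (fderiv ℝ h) (fderiv ℝ (fderiv ℝ h) x) x :=
    ((hh.fderiv_right (m := 1) (by norm_num)).differentiableAt (by simp)).hasFDerivAt
  have h3 : HasFDerivAt (fun y => h y • fderiv ℝ h y) _ x := hd.smul hd2
  rw [h3.fderiv]
  simp

/-- A convex function has non-negative second derivative. -/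
theorem fderiv_fderiv_nonneg_of_convexOn {E : Type*} [NormedAddCommGroup E] [NormedSpace ℝ E]
    {h : E → ℝ} {x : E} (hc : ConvexOn ℝ univ h) (hh : ContDiffAt ℝ 2 h x) (v : E) :
    0 ≤ fderiv ℝ (fderiv ℝ h) x v v := by
  set φ : ℝ → E := fun s => x + s • v with hφ
  have hφd : ∀ s, HasDerivAt φ v s := fun s => by
    have := ((hasDerivAt_id s).smul_const v).const_add x
    rwa [one_smul] at this
  have hφ0 : φ 0 = x := by simp [hφ]
  have hφc : Tendsto φ (𝓝 0) (𝓝 x) := by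
    have := (hφd 0).continuousAt.tendsto; rwa [hφ0] at this
  have hconv : ConvexOn ℝ univ (h ∘ φ) := by
    have := hc.comp_affineMap (AffineMap.lineMap x (x + v) : ℝ →ᵃ[ℝ] E)
    simp only [preimage_univ] at this
    have he : h ∘ φ = h ∘ (AffineMap.lineMap x (x + v) : ℝ →ᵃ[ℝ] E) := by
      ext s
      simp [hφ, AffineMap.lineMap_apply, add_comm]
    rw [he]
    exact this
  have hev : ∀ᶠ s in 𝓝 (0 : ℝ), ContDiffAt ℝ 2 h (φ s) :=
    hφc.eventually (hh.eventually (by simp))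
  have hder : ∀ᶠ s in 𝓝 (0 : ℝ), HasDerivAt (h ∘ φ) (fderiv ℝ h (φ s) v) s := by
    filter_upwards [hev] with s hs
    exact (hs.differentiableAt (by simp)).hasFDerivAt.comp_hasDerivAt s (hφd s)
  have hd2 : HasFDerivAt (fderiv ℝ h) (fderiv ℝ (fderiv ℝ h) x) (φ 0) := by
    rw [hφ0]
    exact ((hh.fderiv_right (m := 1) (by norm_num)).differentiableAt (by simp)).hasFDerivAt
  have hder2 : HasDerivAt (fun s => fderiv ℝ h (φ s) v) (fderiv ℝ (fderiv ℝ h) x v v) 0 := by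
    have := hd2.comp_hasDerivAt (0 : ℝ) (hφd 0)
    simpa using this.clm_apply (hasDerivAt_const (0 : ℝ) v)
  obtain ⟨δ, hδ, hball⟩ := Metric.eventually_nhds_iff_ball.1 hder
  -- On a line the derivative of a convex function is monotone, since both end derivatives are
  -- compared with the same chord slope.
  have hmono : MonotoneOn (fun s => fderiv ℝ h (φ s) v) (Metric.ball 0 δ) := by
    intro a ha b hb hab
    rcases hab.eq_or_lt with rfl | hab
    · rfl
    · have h1 := hconv.le_slope_of_hasDerivAt (mem_univ a) (mem_univ b) hab (hball a ha)
      have h2 := hconv.slope_le_of_hasDerivAt (mem_univ a) (mem_univ b) hab (hball b hb)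
      exact h1.trans h2
  rw [← hder2.deriv]
  rw [← derivWithin_of_isOpen Metric.isOpen_ball (Metric.mem_ball_self hδ)]
  exact hmono.derivWithin_nonneg

/-! ### Smooth norms and their Wulff shapes -/

/-- Support functions of the origin-symmetric bodies with non-empty interior whose boundary is `C²`
with positive curvatures: norms which are `C²` away from the origin and whose Hessian is positive
in all non-radial directions. -/
structure IsSmoothNorm (h : EuclideanSpace ℝ (Fin n) → ℝ) : Prop where
  smul : ∀ (c : ℝ) x, h (c • x) = |c| * h x
  pos : ∀ x, x ≠ 0 → 0 < h x
  convexOn : ConvexOn ℝ univ h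
  contDiffAt : ∀ x, x ≠ 0 → ContDiffAt ℝ 2 h x
  hess_pos : ∀ x, x ≠ 0 → ∀ v, (∀ c : ℝ, v ≠ c • x) → 0 < fderiv ℝ (fderiv ℝ h) x v v

/-- The convex body cut out by the half-spaces `⟨θ, x⟩ ≤ h θ`. -/
def wulff (h : EuclideanSpace ℝ (Fin n) → ℝ) : Set (EuclideanSpace ℝ (Fin n)) :=
  {x | ∀ θ, ‖θ‖ = 1 → inner ℝ θ x ≤ h θ}

namespace IsSmoothNorm

variable {h : EuclideanSpace ℝ (Fin n) → ℝ} (hh : IsSmoothNorm h)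
include hh

theorem map_zero : h 0 = 0 := by simpa using hh.smul 0 0

theorem nonneg (x : EuclideanSpace ℝ (Fin n)) : 0 ≤ h x := by
  rcases eq_or_ne x 0 with rfl | hx
  · exact hh.map_zero.ge
  · exact (hh.pos x hx).le

theorem add_le (x y : EuclideanSpace ℝ (Fin n)) : h (x + y) ≤ h x + h y := by
  have h1 := hh.convexOn.2 (mem_univ x) (mem_univ y) (show (0:ℝ) ≤ 1 / 2 by norm_num)
    (show (0:ℝ) ≤ 1 / 2 by norm_num) (by norm_num)
  rw [← smul_add, hh.smul] at h1
  simp only [smul_eq_mul, abs_of_pos (show (0:ℝ) < 1/2 by norm_num)] at h1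
  linarith

theorem continuous : Continuous h := by
  exact continuousOn_univ.1 (hh.convexOn.continuousOn isOpen_univ)

theorem mem_wulff {x : EuclideanSpace ℝ (Fin n)} : x ∈ wulff h ↔ ∀ θ, inner ℝ θ x ≤ h θ := by
  refine ⟨fun hx θ => ?_, fun hx θ _ => hx θ⟩
  rcases eq_or_ne θ 0 with rfl | hθ
  · simp [hh.map_zero]
  · have hn : 0 < ‖θ‖ := norm_pos_iff.2 hθ
    have h1 := hx (‖θ‖⁻¹ • θ) (by rw [norm_smul, norm_inv, norm_norm, inv_mul_cancel₀ hn.ne'])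
    rw [hh.smul, inner_smul_left, abs_of_pos (inv_pos.2 hn)] at h1
    exact le_of_mul_le_mul_left h1 (inv_pos.2 hn)

/-- Euler's identity for functions homogeneous of degree one. -/
theorem fderiv_self {x : EuclideanSpace ℝ (Fin n)} (hx : x ≠ 0) : fderiv ℝ h x x = h x := by
  have hd : HasFDerivAt h (fderiv ℝ h x) ((fun s : ℝ => s • x) 1) := by
    simpa using ((hh.contDiffAt x hx).differentiableAt (by simp)).hasFDerivAt
  have hl : HasDerivAt (fun s : ℝ => s • x) x 1 := by
    simpa using (hasDerivAt_id (1:ℝ)).smul_const x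
  have h1 := hd.comp_hasDerivAt 1 hl
  have h2 : HasDerivAt (fun s : ℝ => s * h x) (h x) 1 := by
    simpa using (hasDerivAt_id (1:ℝ)).mul_const (h x)
  refine h1.unique (h2.congr_of_eventuallyEq ?_)
  filter_upwards [lt_mem_nhds (show (0:ℝ) < 1 by norm_num)] with s hs
  simp [hh.smul, abs_of_pos hs]

/-- By subadditivity every difference quotient of h at x in a direction y is at most h(y). Together
with Euler's identity this makes ∇h(x) the point of the body where the half-space with normal x is
touched. -/
theorem fderiv_le {x : EuclideanSpace ℝ (Fin n)} (hx : x ≠ 0) (y : EuclideanSpace ℝ (Fin n)) :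
    fderiv ℝ h x y ≤ h y := by
  have hd := ((hh.contDiffAt x hx).differentiableAt (by simp)).hasFDerivAt
  have h1 : HasDerivAt (fun s : ℝ => h (x + s • y)) (fderiv ℝ h x y) 0 := by
    have hl : HasDerivAt (fun s : ℝ => x + s • y) y 0 := by
      simpa using ((hasDerivAt_id (0:ℝ)).smul_const y).const_add x
    have hd' : HasFDerivAt h (fderiv ℝ h x) ((fun s : ℝ => x + s • y) 0) := by simpa using hd
    exact hd'.comp_hasDerivAt 0 hl
  have h2 := h1.hasDerivWithinAt (s := Ioi 0)
  rw [hasDerivWithinAt_iff_tendsto_slope' (by simp)] at h2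
  refine le_of_tendsto h2 ?_
  filter_upwards [self_mem_nhdsWithin] with s hs
  have hs : (0:ℝ) < s := hs
  rw [slope_def_field, sub_zero, div_le_iff₀ hs]
  have := hh.add_le x (s • y)
  rw [hh.smul, abs_of_pos hs] at this
  simp only [zero_smul, add_zero]
  linarith

theorem gradient_mem_wulff {x : EuclideanSpace ℝ (Fin n)} (hx : x ≠ 0) :
    gradient h x ∈ wulff h := by
  rw [hh.mem_wulff]
  intro θ
  rw [real_inner_comm, inner_gradient_left]
  exact hh.fderiv_le hx θ

theorem inner_gradient_self {x : EuclideanSpace ℝ (Fin n)} (hx : x ≠ 0) :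
    inner ℝ x (gradient h x) = h x := by
  rw [real_inner_comm, inner_gradient_left, hh.fderiv_self hx]

/-- The function h - ⟨x, ·⟩ is non-negative and vanishes at θ, so its derivative there is zero.
Hence a normal determines its contact point. -/
theorem eq_gradient {x θ : EuclideanSpace ℝ (Fin n)} (hx : x ∈ wulff h) (hθ : θ ≠ 0)
    (hxθ : inner ℝ θ x = h θ) : x = gradient h θ := by
  have hd := ((hh.contDiffAt θ hθ).differentiableAt (by simp)).hasFDerivAt
  have h1 : HasFDerivAt (fun y => h y - inner ℝ x y) (fderiv ℝ h θ - innerSL ℝ x) θ :=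
    hd.sub (innerSL ℝ x).hasFDerivAt
  have hmin : IsLocalMin (fun y => h y - inner ℝ x y) θ := by
    refine Eventually.of_forall fun y => ?_
    have := hh.mem_wulff.1 hx y
    rw [real_inner_comm] at this hxθ
    simp only
    linarith
  have h2 := hmin.hasFDerivAt_eq_zero h1
  refine ext_inner_right ℝ fun v => ?_
  rw [inner_gradient_left]
  have := congrArg (fun f => f v) h2
  simp at this
  linarith

/-- The Hessian of `h ^ 2 / 2` is positive definite. -/
theorem hess_sq_pos {x : EuclideanSpace ℝ (Fin n)} (hx : x ≠ 0) {v : EuclideanSpace ℝ (Fin n)}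
    (hv : v ≠ 0) : 0 < fderiv ℝ (fderiv ℝ fun y => h y ^ 2 / 2) x v v := by
  rw [fderiv_fderiv_sq_half (hh.contDiffAt x hx)]
  by_cases hvx : ∀ c : ℝ, v ≠ c • x
  · have := mul_pos (hh.pos x hx) (hh.hess_pos x hx v hvx)
    nlinarith [mul_self_nonneg (fderiv ℝ h x v)]
  · push Not at hvx
    obtain ⟨c, rfl⟩ := hvx
    have hc : c ≠ 0 := fun h0 => hv (by simp [h0])
    have h1 := fderiv_fderiv_nonneg_of_convexOn hh.convexOn (hh.contDiffAt x hx) (c • x)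
    have h2 : fderiv ℝ h x (c • x) ≠ 0 := by
      rw [ContinuousLinearMap.map_smul, hh.fderiv_self hx, smul_eq_mul]
      exact mul_ne_zero hc (hh.pos x hx).ne'
    have := mul_nonneg (hh.pos x hx).le h1
    have := mul_self_pos.2 h2
    linarith

/-- A boundary point has only one outer normal. -/
theorem normal_unique {x θ θ' : EuclideanSpace ℝ (Fin n)} (hx : x ∈ wulff h) (hθ : ‖θ‖ = 1)
    (hθ' : ‖θ'‖ = 1) (hxθ : inner ℝ θ x = h θ) (hxθ' : inner ℝ θ' x = h θ') : θ = θ' := by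
  have h0 : θ ≠ 0 := by rintro rfl; simp at hθ
  by_contra hne
  set w := θ' - θ
  by_cases hw : ∀ c : ℝ, w ≠ c • θ
  · have h1 := hh.hess_pos θ h0 w hw
    -- along the segment from `θ` to `θ'` the function `h` is linear
    have hlin : ∀ s ∈ Icc (0:ℝ) 1, h (θ + s • w) = inner ℝ (θ + s • w) x := by
      intro s hs
      refine le_antisymm ?_ (hh.mem_wulff.1 hx _)
      have := hh.convexOn.2 (mem_univ θ) (mem_univ θ') (sub_nonneg.2 hs.2)
        hs.1 (by ring)
      have he : (1 - s) • θ + s • θ' = θ + s • w := by simp only [w]; module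
      rw [he, ← hxθ, ← hxθ', smul_eq_mul, smul_eq_mul] at this
      refine this.trans_eq ?_
      rw [← he, inner_add_left, inner_smul_left, inner_smul_left]
      simp
    have hcont := ((hh.contDiffAt θ h0).fderiv_right (m := 1) (by norm_num)).differentiableAt
      (by simp)
    have hl : HasDerivAt (fun s : ℝ => θ + s • w) w 0 := by
      simpa using ((hasDerivAt_id (0:ℝ)).smul_const w).const_add θ
    have hd2 : HasDerivAt (fun s : ℝ => fderiv ℝ h (θ + s • w)) (fderiv ℝ (fderiv ℝ h) θ w) 0 := by
      have : HasFDerivAt (fderiv ℝ h) (fderiv ℝ (fderiv ℝ h) θ) ((fun s : ℝ => θ + s • w) 0) := by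
        simpa using hcont.hasFDerivAt
      exact this.comp_hasDerivAt (0:ℝ) hl
    have hd3 : HasDerivAt (fun s : ℝ => fderiv ℝ h (θ + s • w) w)
        (fderiv ℝ (fderiv ℝ h) θ w w) 0 := by
      simpa using hd2.clm_apply (hasDerivAt_const (0 : ℝ) w)
    have hnz : ∀ s ∈ Icc (0:ℝ) 1, θ + s • w ≠ 0 := by
      intro s hs h00
      have := hlin s hs
      by_cases hs0 : s = 0
      · subst hs0; simp at h00; exact h0 h00
      · apply hw (-s⁻¹)
        have : s • w = -θ := by rw [add_comm] at h00; exact eq_neg_of_add_eq_zero_left h00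
        rw [neg_smul, ← smul_neg, ← this, smul_smul, inv_mul_cancel₀ hs0, one_smul]
    -- All normals on the segment touch the body at x, so ∇h = x along it. The second derivative in
    -- direction w is then zero, against `hess_pos`; one-sided differentiation at s = 0 is enough.
    have hconst : ∀ s ∈ Icc (0:ℝ) 1, fderiv ℝ h (θ + s • w) w = inner ℝ x w := by
      intro s hs
      rw [← inner_gradient_left, ← hh.eq_gradient hx (hnz s hs) (hlin s hs).symm]
    have hd4 : HasDerivWithinAt (fun s : ℝ => fderiv ℝ h (θ + s • w) w) 0 (Icc 0 1) 0 :=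
      (hasDerivWithinAt_const (0:ℝ) _ (inner ℝ x w)).congr (fun s hs => hconst s hs)
        (hconst 0 (by simp))
    have := (uniqueDiffOn_Icc (zero_lt_one' ℝ) 0 (by simp)).eq_deriv _ hd3.hasDerivWithinAt hd4
    linarith
  · push Not at hw
    obtain ⟨c, hc⟩ := hw
    have hθc : θ' = (c + 1) • θ := by rw [add_smul, ← hc]; simp [w]
    have habs : |c + 1| = 1 := by
      have := congrArg norm hθc
      rwa [norm_smul, hθ, hθ', mul_one, Real.norm_eq_abs, eq_comm] at this
    -- The opposite normal is excluded: ⟨-θ, x⟩ = -h(θ) < 0 < h(-θ).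
    rcases eq_or_eq_neg_of_abs_eq habs with h1 | h1
    · rw [h1, one_smul] at hθc; exact hne hθc.symm
    · rw [hθc, h1, hh.smul, inner_smul_left, hxθ] at hxθ'
      have := hh.pos θ h0
      simp at hxθ'
      linarith

end IsSmoothNorm

/-! ### Topology of the Wulff shape and its Gauss map -/

theorem convex_wulff (h : EuclideanSpace ℝ (Fin n) → ℝ) : Convex ℝ (wulff h) := by
  intro x hx y hy a b ha hb hab θ hθ
  rw [inner_add_right, inner_smul_right, inner_smul_right]
  calc a * inner ℝ θ x + b * inner ℝ θ y ≤ a * h θ + b * h θ :=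
        add_le_add (mul_le_mul_of_nonneg_left (hx θ hθ) ha) (mul_le_mul_of_nonneg_left (hy θ hθ) hb)
    _ = h θ := by rw [← add_mul, hab, one_mul]

theorem isClosed_wulff (h : EuclideanSpace ℝ (Fin n) → ℝ) : IsClosed (wulff h) := by
  have : wulff h = ⋂ θ, ⋂ (_ : ‖θ‖ = 1), {x | inner ℝ θ x ≤ h θ} := by
    ext x; simp [wulff]
  rw [this]
  exact isClosed_iInter fun θ => isClosed_iInter fun _ =>
    isClosed_le (continuous_const.inner continuous_id) continuous_const

namespace IsSmoothNorm

variable {h : EuclideanSpace ℝ (Fin n) → ℝ} (hh : IsSmoothNorm h)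
include hh

theorem exists_le_norm : ∃ R, 0 < R ∧ ∀ x, h x ≤ R * ‖x‖ := by
  have hc : IsCompact (Metric.sphere (0 : EuclideanSpace ℝ (Fin n)) 1) := isCompact_sphere _ _
  obtain ⟨C, hC⟩ := (hc.image hh.continuous).bddAbove
  refine ⟨max C 1, by positivity, fun x => ?_⟩
  rcases eq_or_ne x 0 with rfl | hx
  · simp [hh.map_zero]
  · have hn : 0 < ‖x‖ := norm_pos_iff.2 hx
    have h1 : h (‖x‖⁻¹ • x) ≤ C := hC (mem_image_of_mem h (by
      rw [mem_sphere_zero_iff_norm, norm_smul, norm_inv, norm_norm, inv_mul_cancel₀ hn.ne']))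
    rw [hh.smul, abs_of_pos (inv_pos.2 hn), inv_mul_le_iff₀ hn] at h1
    calc h x ≤ ‖x‖ * C := h1
      _ ≤ max C 1 * ‖x‖ := by rw [mul_comm]; gcongr; exact le_max_left _ _

theorem exists_norm_le : ∃ r, 0 < r ∧ ∀ x, r * ‖x‖ ≤ h x := by
  rcases isEmpty_or_nonempty (Metric.sphere (0 : EuclideanSpace ℝ (Fin n)) 1) with he | hne
  · refine ⟨1, one_pos, fun x => ?_⟩
    rcases eq_or_ne x 0 with rfl | hx
    · simp [hh.map_zero]
    · exact (he.false ⟨‖x‖⁻¹ • x, by simp [norm_smul, hx]⟩).elim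
  · have hc : IsCompact (Metric.sphere (0 : EuclideanSpace ℝ (Fin n)) 1) := isCompact_sphere _ _
    obtain ⟨θ, hθ, hmin⟩ := hc.exists_isMinOn (nonempty_coe_sort.1 hne) hh.continuous.continuousOn
    refine ⟨h θ, hh.pos θ (by rintro rfl; simp at hθ), fun x => ?_⟩
    rcases eq_or_ne x 0 with rfl | hx
    · simp [hh.map_zero]
    · have hn : 0 < ‖x‖ := norm_pos_iff.2 hx
      have h1 : h θ ≤ h (‖x‖⁻¹ • x) := hmin (by
        rw [mem_sphere_zero_iff_norm, norm_smul, norm_inv, norm_norm, inv_mul_cancel₀ hn.ne'])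
      rw [hh.smul, abs_of_pos (inv_pos.2 hn), le_inv_mul_iff₀ hn, mul_comm] at h1
      exact h1

theorem isCompact_wulff : IsCompact (wulff h) := by
  obtain ⟨R, hR0, hR⟩ := hh.exists_le_norm
  refine Metric.isCompact_of_isClosed_isBounded (isClosed_wulff h)
    ((Metric.isBounded_closedBall (x := 0) (r := R)).subset fun x hx => ?_)
  rw [mem_closedBall_zero_iff]
  have h1 := hh.mem_wulff.1 hx x
  rw [real_inner_self_eq_norm_sq] at h1
  rcases eq_or_ne x 0 with rfl | hx0
  · simpa using hR0.le
  · have h2 := h1.trans (hR x)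
    rw [sq] at h2
    exact le_of_mul_le_mul_right h2 (norm_pos_iff.2 hx0)

theorem wulff_mem_nhds : wulff h ∈ 𝓝 0 := by
  obtain ⟨r, hr, hle⟩ := hh.exists_norm_le
  refine mem_of_superset (Metric.closedBall_mem_nhds 0 hr) fun x hx => ?_
  rw [hh.mem_wulff]
  intro θ
  rw [mem_closedBall_zero_iff] at hx
  calc inner ℝ θ x ≤ ‖θ‖ * ‖x‖ := real_inner_le_norm _ _
    _ ≤ r * ‖θ‖ := by rw [mul_comm]; gcongr
    _ ≤ h θ := hle θ

theorem isOriginSymmetric_wulff : IsOriginSymmetric (wulff h) := by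
  intro x hx θ hθ
  have := hh.mem_wulff.1 hx (-θ)
  have h1 := hh.smul (-1) θ
  simp at h1
  rwa [h1, inner_neg_left, ← inner_neg_right] at this

/-- The supremum is attained at ∇h(θ). -/
theorem supportFun_wulff {θ : EuclideanSpace ℝ (Fin n)} (hθ : θ ≠ 0) :
    supportFun (wulff h) θ = h θ := by
  refine IsLUB.csSup_eq (IsGreatest.isLUB ⟨⟨gradient h θ, hh.gradient_mem_wulff hθ,
    hh.inner_gradient_self hθ⟩, ?_⟩) ⟨_, ⟨gradient h θ, hh.gradient_mem_wulff hθ, rfl⟩⟩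
  rintro _ ⟨x, hx, rfl⟩
  exact hh.mem_wulff.1 hx θ

/-- Every boundary point has an outer normal. -/
theorem exists_normal {x : EuclideanSpace ℝ (Fin n)} (hx : x ∈ frontier (wulff h)) :
    ∃ θ, ‖θ‖ = 1 ∧ inner ℝ θ x = h θ := by
  have hxK : x ∈ wulff h := (isClosed_wulff h).frontier_subset hx
  by_contra hcon
  push Not at hcon
  have hlt : ∀ θ ∈ Metric.sphere (0 : EuclideanSpace ℝ (Fin n)) 1, 0 < h θ - inner ℝ θ x :=
    fun θ hθ => sub_pos.2 (lt_of_le_of_ne (hh.mem_wulff.1 hxK θ)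
      (hcon θ (mem_sphere_zero_iff_norm.1 hθ)))
  have hc : IsCompact (Metric.sphere (0 : EuclideanSpace ℝ (Fin n)) 1) := isCompact_sphere _ _
  -- If no half-space is touched at x, compactness of the sphere gives a uniform slack δ, so a
  -- δ-ball around x stays in the body.
  obtain ⟨δ, hδ, hle⟩ : ∃ δ, 0 < δ ∧ ∀ θ ∈ Metric.sphere (0 : EuclideanSpace ℝ (Fin n)) 1,
      δ ≤ h θ - inner ℝ θ x :=
    hc.exists_forall_le' (f := fun θ => h θ - inner ℝ θ x)
      (hh.continuous.sub (continuous_id.inner continuous_const)).continuousOn hlt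
  apply hx.2
  rw [mem_interior_iff_mem_nhds]
  refine mem_of_superset (Metric.closedBall_mem_nhds x hδ) fun y hy θ hθ => ?_
  have h1 := hle θ (mem_sphere_zero_iff_norm.2 hθ)
  have h2 : inner ℝ θ (y - x) ≤ δ := by
    refine (real_inner_le_norm _ _).trans ?_
    rw [hθ, one_mul, ← dist_eq_norm]
    exact hy
  rw [inner_sub_right] at h2
  linarith

theorem mem_frontier_of_inner_eq {x θ : EuclideanSpace ℝ (Fin n)} (hx : x ∈ wulff h) (hθ : θ ≠ 0)
    (hxθ : inner ℝ θ x = h θ) : x ∈ frontier (wulff h) := by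
  refine ⟨subset_closure hx, fun hint => ?_⟩
  rw [mem_interior_iff_mem_nhds] at hint
  have hcont : Tendsto (fun s : ℝ => x + s • θ) (𝓝[>] 0) (𝓝 x) := by
    have : Continuous (fun s : ℝ => x + s • θ) := by fun_prop
    have h1 := this.tendsto 0
    simp only [zero_smul, add_zero] at h1
    exact h1.mono_left nhdsWithin_le_nhds
  obtain ⟨s, hs, hs0⟩ := ((hcont.eventually hint).and self_mem_nhdsWithin).exists
  have hs0 : 0 < s := hs0
  have h1 := hh.mem_wulff.1 hs θ
  rw [inner_add_right, inner_smul_right, hxθ, real_inner_self_eq_norm_sq] at h1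
  have : 0 < s * ‖θ‖ ^ 2 := by positivity
  linarith

theorem gaussMap_spec {x : EuclideanSpace ℝ (Fin n)} (hx : x ∈ frontier (wulff h)) :
    ‖gaussMap (wulff h) x‖ = 1 ∧ inner ℝ (gaussMap (wulff h) x) x = h (gaussMap (wulff h) x) := by
  have hex : ∃ v, ‖v‖ = 1 ∧ ∀ y ∈ wulff h, inner ℝ v y ≤ inner ℝ v x := by
    obtain ⟨θ, hθ, hxθ⟩ := hh.exists_normal hx
    exact ⟨θ, hθ, fun y hy => hxθ ▸ hh.mem_wulff.1 hy θ⟩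
  obtain ⟨h1, h2⟩ := Classical.epsilon_spec hex
  have hne : gaussMap (wulff h) x ≠ 0 := fun h0 => by
    change ‖gaussMap (wulff h) x‖ = 1 at h1
    rw [h0] at h1; simp at h1
  refine ⟨h1, le_antisymm (hh.mem_wulff.1 ((isClosed_wulff h).frontier_subset hx) _) ?_⟩
  rw [← hh.inner_gradient_self hne]
  exact h2 _ (hh.gradient_mem_wulff hne)

theorem gaussMap_eq {x θ : EuclideanSpace ℝ (Fin n)} (hx : x ∈ frontier (wulff h)) (hθ : ‖θ‖ = 1)
    (hxθ : inner ℝ θ x = h θ) : gaussMap (wulff h) x = θ :=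
  hh.normal_unique ((isClosed_wulff h).frontier_subset hx) (hh.gaussMap_spec hx).1 hθ
    (hh.gaussMap_spec hx).2 hxθ

theorem gaussMap_gaussMapInv {θ : EuclideanSpace ℝ (Fin n)} (hθ : ‖θ‖ = 1) :
    gaussMap (wulff h) (gaussMapInv (wulff h) θ) = θ := by
  have h0 : θ ≠ 0 := by rintro rfl; simp at hθ
  have hfr := hh.mem_frontier_of_inner_eq (hh.gradient_mem_wulff h0) h0 (hh.inner_gradient_self h0)
  exact Function.invFunOn_eq ⟨_, hfr, hh.gaussMap_eq hfr hθ (hh.inner_gradient_self h0)⟩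

/-- The Gauss map is continuous. -/
theorem continuousOn_gaussMap : ContinuousOn (gaussMap (wulff h)) (frontier (wulff h)) := by
  rw [continuousOn_iff_continuous_domRestrict, continuous_iff_continuousAt]
  intro x
  have hc : IsCompact (Metric.sphere (0 : EuclideanSpace ℝ (Fin n)) 1) := isCompact_sphere _ _
  -- The normals lie in a compact sphere, and each cluster point is a normal at x by continuity of
  -- h; uniqueness of the normal then yields convergence.
  refine hc.tendsto_nhds_of_unique_mapClusterPt (Eventually.of_forall fun y =>
    mem_sphere_zero_iff_norm.2 (hh.gaussMap_spec y.2).1) fun θ hθ hcl => ?_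
  refine (hh.gaussMap_eq x.2 (mem_sphere_zero_iff_norm.1 hθ) ?_).symm
  obtain ⟨U, hU, hlim⟩ := mapClusterPt_iff_ultrafilter.1 hcl
  have hlim' : Tendsto (fun y : frontier (wulff h) => gaussMap (wulff h) y) U (𝓝 θ) := hlim
  have hx : Tendsto (fun y : frontier (wulff h) => (y : EuclideanSpace ℝ (Fin n))) U (𝓝 x) :=
    continuous_subtype_val.continuousAt.tendsto.mono_left hU
  refine tendsto_nhds_unique (hlim'.inner hx) (((hh.continuous.tendsto θ).comp hlim').congr
    fun y => (hh.gaussMap_spec y.2).2.symm)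

end IsSmoothNorm

/-! ### The Wulff shape is of class C²₊ -/

namespace IsSmoothNorm

variable {h : EuclideanSpace ℝ (Fin n) → ℝ} (hh : IsSmoothNorm h)
include hh

theorem gradient_smul {x : EuclideanSpace ℝ (Fin n)} (hx : x ≠ 0) {c : ℝ} (hc : 0 < c) :
    gradient h (c • x) = gradient h x := by
  refine (hh.eq_gradient (hh.gradient_mem_wulff (smul_ne_zero hc.ne' hx)) hx ?_)
  have := hh.inner_gradient_self (smul_ne_zero hc.ne' hx)
  rw [hh.smul, inner_smul_left, abs_of_pos hc] at this
  exact mul_left_cancel₀ hc.ne' this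

theorem fderiv_sq_half {x : EuclideanSpace ℝ (Fin n)} (hx : x ≠ 0) :
    HasFDerivAt (fun y => h y ^ 2 / 2) (h x • fderiv ℝ h x) x := by
  have hd := ((hh.contDiffAt x hx).differentiableAt (by simp)).hasFDerivAt
  simp only [div_eq_mul_inv]
  refine ((hd.pow 2).mul_const (2⁻¹ : ℝ)).congr_fderiv ?_
  ext z
  simp
  ring

/-- The Wulff shape of a smooth norm is of class `C²₊`: near a boundary point it is a sublevel set
of the Legendre transform of `h ^ 2 / 2`. -/
theorem isC2Plus : IsC2Plus (wulff h) := by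
  refine ⟨hh.isCompact_wulff, convex_wulff h, ⟨0, mem_interior_iff_mem_nhds.2 hh.wulff_mem_nhds⟩,
    fun x₀ hx₀ => ?_⟩
  obtain ⟨θ₁, hθ₁, hxθ₁⟩ := hh.exists_normal hx₀
  have hθ₁0 : θ₁ ≠ 0 := by rintro rfl; simp at hθ₁
  have hpos := hh.pos θ₁ hθ₁0
  -- Normalised so that h(θ₀) = 1; then F = ∇(h²/2) = h∇h sends θ₀ to x₀.
  set θ₀ := (h θ₁)⁻¹ • θ₁ with hθ₀def
  have hθ₀ : θ₀ ≠ 0 := smul_ne_zero (inv_ne_zero hpos.ne') hθ₁0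
  have hhθ₀ : h θ₀ = 1 := by
    rw [hθ₀def, hh.smul, abs_of_pos (inv_pos.2 hpos), inv_mul_cancel₀ hpos.ne']
  have hgrad₀ : gradient h θ₀ = x₀ := by
    rw [hθ₀def, hh.gradient_smul hθ₁0 (inv_pos.2 hpos)]
    exact (hh.eq_gradient ((isClosed_wulff h).frontier_subset hx₀) hθ₁0 hxθ₁).symm
  set f : EuclideanSpace ℝ (Fin n) → ℝ := fun y => h y ^ 2 / 2 with hf
  have hfc : ∀ θ, θ ≠ 0 → ContDiffAt ℝ 2 f θ := fun θ hθ => by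
    exact ((hh.contDiffAt θ hθ).pow 2).div_const 2
  have hF1 : ContDiffAt ℝ 1 (fderiv ℝ f) θ₀ := (hfc θ₀ hθ₀).fderiv_right (by norm_num)
  let T : (EuclideanSpace ℝ (Fin n) →L[ℝ] ℝ) →L[ℝ] EuclideanSpace ℝ (Fin n) :=
    { toFun := (InnerProductSpace.toDual ℝ (EuclideanSpace ℝ (Fin n))).symm
      map_add' := map_add _
      map_smul' := fun c x => by simp
      cont := (InnerProductSpace.toDual ℝ (EuclideanSpace ℝ (Fin n))).symm.continuous }
  have hTi : ∀ L v, inner ℝ (T L) v = L v := fun L v =>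
    InnerProductSpace.toDual_symm_apply
  set F : EuclideanSpace ℝ (Fin n) → EuclideanSpace ℝ (Fin n) := gradient f with hFdef
  have hFT : F = T ∘ fderiv ℝ f := rfl
  have hFval : ∀ θ, θ ≠ 0 → F θ = h θ • gradient h θ := fun θ hθ => by
    refine ext_inner_right ℝ fun v => ?_
    rw [hFdef, inner_gradient_left, inner_smul_left, inner_gradient_left,
      (hh.fderiv_sq_half hθ).fderiv]
    simp
  have hFc : ContDiffAt ℝ 1 F θ₀ := by
    rw [hFT]
    exact T.contDiff.contDiffAt.comp θ₀ hF1
  have hFd : HasFDerivAt F (T.comp (fderiv ℝ (fderiv ℝ f) θ₀)) θ₀ := by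
    rw [hFT]
    exact T.hasFDerivAt.comp θ₀ (hF1.differentiableAt (by simp)).hasFDerivAt
  set D := T.comp (fderiv ℝ (fderiv ℝ f) θ₀) with hD
  have hDv : ∀ v w, inner ℝ (D v) w = fderiv ℝ (fderiv ℝ f) θ₀ v w := fun v w => by
    rw [hD, ContinuousLinearMap.comp_apply, hTi]
  have hDinj : Function.Injective D := by
    rw [injective_iff_map_eq_zero]
    intro v hv
    by_contra hv0
    have := hh.hess_sq_pos hθ₀ hv0
    rw [← hf, ← hDv, hv] at this
    simp at this
  let D' : EuclideanSpace ℝ (Fin n) ≃L[ℝ] EuclideanSpace ℝ (Fin n) :=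
    (LinearEquiv.ofInjectiveEndo (D : _ →ₗ[ℝ] _) hDinj).toContinuousLinearEquiv
  have hD' : (D' : _ →L[ℝ] _) = D := by ext v; rfl
  have hFd' : HasFDerivAt F (D' : _ →L[ℝ] _) θ₀ := hD' ▸ hFd
  set P := hFc.toOpenPartialHomeomorph F hFd' (by simp) with hP
  set ψ := hFc.localInverse hFd' (by simp) with hψ
  have hFθ₀ : F θ₀ = x₀ := by rw [hFval θ₀ hθ₀, hhθ₀, one_smul, hgrad₀]
  have hψ₀ : ψ x₀ = θ₀ := by
    rw [← hFθ₀]; exact hFc.localInverse_apply_image hFd' (by simp)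
  have hψc : ContDiffAt ℝ 1 ψ x₀ := by
    rw [← hFθ₀]; exact hFc.to_localInverse hFd' (by simp)
  have hright : ∀ᶠ x in 𝓝 x₀, F (ψ x) = x := by
    have ht : x₀ ∈ P.target := hFθ₀ ▸ hFc.image_mem_toOpenPartialHomeomorph_target hFd' (by simp)
    filter_upwards [P.open_target.mem_nhds ht] with x hx
    exact P.right_inv hx
  have hne : ∀ᶠ x in 𝓝 x₀, ψ x ≠ 0 :=
    hψc.continuousAt.eventually_ne (by rw [hψ₀]; exact hθ₀)
  have hψdiff : ∀ᶠ x in 𝓝 x₀, DifferentiableAt ℝ ψ x := by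
    filter_upwards [hψc.eventually (by simp)] with x hx
    exact hx.differentiableAt (by simp)
  -- Legendre transform of f minus 1/2, where ψ is the local inverse of ∇f. The terms containing ψ'
  -- cancel because ∇f(ψ x) = x, so ∇g = ψ; as ψ is C¹, g is C².
  set g : EuclideanSpace ℝ (Fin n) → ℝ := fun x => inner ℝ x (ψ x) - f (ψ x) - 1 / 2 with hg
  have hgd : ∀ᶠ x in 𝓝 x₀, HasFDerivAt g (innerSL ℝ (ψ x)) x := by
    filter_upwards [hright, hne, hψdiff] with x h1 h2 h3
    have hfd : HasFDerivAt f (fderiv ℝ f (ψ x)) (ψ x) :=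
      ((hfc _ h2).differentiableAt (by simp)).hasFDerivAt
    have h4 := (((hasFDerivAt_id x).inner ℝ h3.hasFDerivAt).sub
      (hfd.comp x h3.hasFDerivAt)).sub_const (1 / 2 : ℝ)
    refine h4.congr_fderiv ?_
    ext v
    have h5 : fderiv ℝ f (ψ x) (fderiv ℝ ψ x v) = inner ℝ x (fderiv ℝ ψ x v) := by
      rw [← inner_gradient_left, ← hFdef, h1]
    simp [h5, real_inner_comm]
  have hgd₁ : fderiv ℝ g =ᶠ[𝓝 x₀] fun x => innerSL ℝ (ψ x) := by
    filter_upwards [hgd] with x hx using hx.fderiv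
  have hgg : fderiv ℝ g x₀ = innerSL ℝ θ₀ := by rw [hgd₁.eq_of_nhds, hψ₀]
  refine ⟨g, ?_, ?_, ?_, ?_⟩
  · rw [show (2 : WithTop ℕ∞) = (1 : ℕ) + 1 by norm_num, contDiffAt_succ_iff_hasFDerivAt]
    exact ⟨fun x => innerSL ℝ (ψ x), ⟨_, hgd, fun x hx => hx⟩,
      (innerSL ℝ).contDiff.contDiffAt.comp x₀ hψc⟩
  · filter_upwards [hright, hne] with x h1 h2
    have hp := hh.pos _ h2
    have hx : x = h (ψ x) • gradient h (ψ x) := by rw [← hFval _ h2, h1]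
    have hin : inner ℝ (ψ x) x = h (ψ x) ^ 2 :=
      (congrArg (fun z => inner ℝ (ψ x) z) hx).trans (by
        rw [inner_smul_right, hh.inner_gradient_self h2, sq])
    -- So g x ≤ 0 means h(ψ x) ≤ 1. Since x = h(ψ x) · ∇h(ψ x), this puts x on the segment from 0 to
    -- a point of the body.
    have hgx : g x = (h (ψ x) ^ 2 - 1) / 2 := by
      simp only [hg, hf]
      rw [real_inner_comm, hin]; ring
    rw [hgx]
    constructor
    · intro hxK
      have := hh.mem_wulff.1 hxK (ψ x)
      rw [hin] at this
      nlinarith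
    · intro hle
      have hle1 : h (ψ x) ≤ 1 := by nlinarith
      rw [hx]
      exact (convex_wulff h).smul_mem_of_zero_mem (mem_of_mem_nhds hh.wulff_mem_nhds)
        (hh.gradient_mem_wulff h2) ⟨hp.le, hle1⟩
  · rw [hgg]
    intro h0
    have := congrArg (fun L => L θ₀) h0
    simp at this
    exact hθ₀ this
  · intro v hv _
    have hψd : HasFDerivAt ψ (fderiv ℝ ψ x₀) x₀ := (hψc.differentiableAt (by simp)).hasFDerivAt
    have h1 : HasFDerivAt (fun x => innerSL ℝ (ψ x)) ((innerSL ℝ).comp (fderiv ℝ ψ x₀)) x₀ :=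
      (innerSL ℝ).hasFDerivAt.comp x₀ hψd
    rw [hgd₁.fderiv_eq, h1.fderiv]
    -- The Hessian of g at x₀ is the inverse of the Hessian D of f: with w = D⁻¹v it takes the value
    -- ⟨w, Dw⟩ > 0, in every direction and not only on the tangent space.
    set w := fderiv ℝ ψ x₀ v with hw
    have hFw : D w = v := by
      have h2 : HasFDerivAt F D (ψ x₀) := hψ₀.symm ▸ hFd
      have h3 := (h2.comp x₀ hψd).congr_of_eventuallyEq
        (f₁ := id) (hright.mono fun x hx => hx.symm)
      have := congrArg (fun L => L v) (h3.unique (hasFDerivAt_id x₀))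
      simpa using this
    have hw0 : w ≠ 0 := fun h0 => hv (by rw [← hFw, h0, D.map_zero])
    have := hh.hess_sq_pos hθ₀ hw0
    rw [← hf, ← hDv, hFw, real_inner_comm] at this
    simpa using this

end IsSmoothNorm

/-! ### Surface measure against the volume of thin shells -/

/-- `ν` is a continuous field of outer unit normals of the convex body `K`, which contains the
origin in its interior. -/
structure IsNormalField (K : Set (EuclideanSpace ℝ (Fin n)))
    (ν : EuclideanSpace ℝ (Fin n) → EuclideanSpace ℝ (Fin n)) : Prop where
  isCompact : IsCompact K
  convex : Convex ℝ K
  mem_nhds : K ∈ 𝓝 0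
  continuousOn : ContinuousOn ν (frontier K)
  norm_eq : ∀ x ∈ frontier K, ‖ν x‖ = 1
  inner_le : ∀ x ∈ frontier K, ∀ y ∈ K, inner ℝ (ν x) y ≤ inner ℝ (ν x) x

theorem IsSmoothNorm.isNormalField {h : EuclideanSpace ℝ (Fin n) → ℝ} (hh : IsSmoothNorm h) :
    IsNormalField (wulff h) (gaussMap (wulff h)) where
  isCompact := hh.isCompact_wulff
  convex := convex_wulff h
  mem_nhds := hh.wulff_mem_nhds
  continuousOn := hh.continuousOn_gaussMap
  norm_eq x hx := (hh.gaussMap_spec hx).1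
  inner_le x hx y hy := by
    rw [(hh.gaussMap_spec hx).2]
    exact hh.mem_wulff.1 hy _

/-- The part of the cone over `A` where the gauge of `K` is larger than `1 - δ`. -/
def coneShell (K A : Set (EuclideanSpace ℝ (Fin n))) (δ : ℝ) : Set (EuclideanSpace ℝ (Fin n)) :=
  {x | 1 - δ < gauge K x ∧ gauge K x ≤ 1 ∧ (gauge K x)⁻¹ • x ∈ A}

namespace IsNormalField

variable {K : Set (EuclideanSpace ℝ (Fin n))}
  {ν : EuclideanSpace ℝ (Fin n) → EuclideanSpace ℝ (Fin n)} (hν : IsNormalField K ν)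
include hν

theorem frontier_subset : frontier K ⊆ K := hν.isCompact.isClosed.frontier_subset

theorem gauge_eq_one {x : EuclideanSpace ℝ (Fin n)} (hx : x ∈ frontier K) : gauge K x = 1 :=
  (gauge_eq_one_iff_mem_frontier hν.convex hν.mem_nhds).2 hx

/-- A small positive multiple of ν(x) lies in K and has positive inner product with ν(x). -/
theorem inner_pos {x : EuclideanSpace ℝ (Fin n)} (hx : x ∈ frontier K) :
    0 < inner ℝ (ν x) x := by
  have hc : Tendsto (fun s : ℝ => s • ν x) (𝓝[>] 0) (𝓝 0) := by
    have : Continuous (fun s : ℝ => s • ν x) := by fun_prop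
    have h1 := this.tendsto 0
    simp only [zero_smul] at h1
    exact h1.mono_left nhdsWithin_le_nhds
  obtain ⟨s, hs, hs0⟩ := ((hc.eventually hν.mem_nhds).and self_mem_nhdsWithin).exists
  have hs0 : 0 < s := hs0
  have h1 := hν.inner_le x hx _ hs
  rw [inner_smul_right, real_inner_self_eq_norm_sq, hν.norm_eq x hx] at h1
  nlinarith

/-- A continuous normal makes the boundary almost flat near x₀: ⟨ν(a), a - b⟩ ≥ 0 for b ∈ K,
replacing ν(a) by ν(x₀) costs κ‖a - b‖, and exchanging a and b gives the other side. -/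
theorem exists_abs_inner_sub_le {x₀ : EuclideanSpace ℝ (Fin n)} (hx₀ : x₀ ∈ frontier K) {κ : ℝ}
    (hκ : 0 < κ) : ∃ r > 0, ∀ a ∈ frontier K ∩ Metric.ball x₀ r,
      ∀ b ∈ frontier K ∩ Metric.ball x₀ r, |inner ℝ (ν x₀) (a - b)| ≤ κ * ‖a - b‖ := by
  obtain ⟨r, hr, hcl⟩ := Metric.continuousOn_iff.1 hν.continuousOn x₀ hx₀ κ hκ
  have key : ∀ a ∈ frontier K ∩ Metric.ball x₀ r, ∀ b ∈ frontier K,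
      -(κ * ‖a - b‖) ≤ inner ℝ (ν x₀) (a - b) := by
    intro a ha b hb
    have h1 := hν.inner_le a ha.1 b (hν.frontier_subset hb)
    have h2 : inner ℝ (ν a - ν x₀) (a - b) ≤ κ * ‖a - b‖ := by
      refine (real_inner_le_norm _ _).trans ?_
      gcongr
      rw [← dist_eq_norm]
      exact (hcl a ha.1 ha.2).le
    rw [inner_sub_left, inner_sub_right (ν a)] at h2
    linarith
  refine ⟨r, hr, fun a ha b hb => abs_le.2 ⟨key a ha b hb.1, ?_⟩⟩
  have h1 := key b hb a ha.1
  have h2 : inner ℝ (ν x₀) (b - a) = -inner ℝ (ν x₀) (a - b) := by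
    rw [← inner_neg_right, neg_sub]
  rw [h2, norm_sub_rev] at h1
  linarith

end IsNormalField

/-- The volume of a right cylinder. -/
theorem volume_cylinder {e : EuclideanSpace ℝ (Fin n)} (he : ‖e‖ = 1) (B : Set (ℝ ∙ e)ᗮ)
    (S : Set ℝ) :
    volume {z : EuclideanSpace ℝ (Fin n) | inner ℝ e z ∈ S ∧ (ℝ ∙ e)ᗮ.orthogonalProjectionOnto z ∈ B}
      = volume S * volume B := by
  have h1 := (ℝ ∙ e).measurePreserving_measurableEquivProd (0 : EuclideanSpace ℝ (Fin n))
  rw [InnerProductSpace.euclideanHausdorffMeasure_eq_volume] at h1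
  let T : ℝ ≃ₗᵢ[ℝ] (ℝ ∙ e) := LinearIsometryEquiv.toSpanUnitSingleton e he
  have h2 : volume S = volume (T.symm ⁻¹' S) :=
    (T.symm.measurePreserving.measure_preimage_equiv (f := T.symm.toMeasurableEquiv) S).symm
  rw [h2, ← Measure.prod_prod, ← Measure.volume_eq_prod, ← h1.measure_preimage_equiv]
  congr 1
  ext z
  have h3 : T.symm ((ℝ ∙ e).orthogonalProjectionOnto z) = inner ℝ e z := by
    rw [LinearIsometryEquiv.symm_apply_eq]
    ext1
    rw [Submodule.coe_orthogonalProjectionOnto_apply, Submodule.starProjection_unit_singleton ℝ he]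
    simp [T]
  simp [h3]

theorem euclideanHausdorffMeasure_image_le {X Y : Type*} [MetricSpace X] [MeasurableSpace X]
    [BorelSpace X] [MetricSpace Y] [MeasurableSpace Y] [BorelSpace Y] {C : NNReal} {f : X → Y}
    {s : Set X} (hf : LipschitzOnWith C f s) (d : ℕ) :
    μHE[d] (f '' s) ≤ (C : ENNReal) ^ d * μHE[d] s := by
  rw [Measure.euclideanHausdorffMeasure_def, Measure.euclideanHausdorffMeasure_def,
    Measure.smul_apply, Measure.smul_apply, ENNReal.smul_def, smul_eq_mul, ENNReal.smul_def,
    smul_eq_mul, mul_left_comm]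
  gcongr
  simpa using hf.hausdorffMeasure_image_le (d := d) (by positivity)

namespace IsNormalField

variable {K : Set (EuclideanSpace ℝ (Fin n))}
  {ν : EuclideanSpace ℝ (Fin n) → EuclideanSpace ℝ (Fin n)} (hν : IsNormalField K ν)
include hν

set_option maxHeartbeats 1000000 in
/-- Near a boundary point `x₀` the surface measure is controlled by the volume of thin shells. -/
theorem exists_surface_le_shell {x₀ : EuclideanSpace ℝ (Fin n)} (hx₀ : x₀ ∈ frontier K) {C : ℝ}
    (hC : 1 < C) : ∃ r > 0, ∃ δ ∈ Ioo (0 : ℝ) 1, ∀ A ⊆ frontier K ∩ Metric.ball x₀ r,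
      ENNReal.ofReal (inner ℝ (ν x₀) x₀ * δ) * μHE[n - 1] A ≤
        ENNReal.ofReal C * volume (coneShell K A δ) := by
  -- The patch A is projected along x₀ to B in the tangent directions V; the inverse is almost
  -- 1-Lipschitz, so A has hardly more area than B. The cylinder of height δ over B is mapped into
  -- the cone shell by a map close to the linear T, which fixes V, sends e to x₀ and has determinant
  -- h₀. Each comparison costs one factor √C.
  set e := ν x₀ with he
  have he1 : ‖e‖ = 1 := hν.norm_eq x₀ hx₀
  set h₀ := inner ℝ e x₀ with hh₀
  have hh₀pos : 0 < h₀ := hν.inner_pos hx₀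
  set V := (ℝ ∙ e)ᗮ with hV
  let p : EuclideanSpace ℝ (Fin n) →L[ℝ] V := V.orthogonalProjectionOnto
  have hp : ∀ z, (p z : EuclideanSpace ℝ (Fin n)) = z - inner ℝ e z • e := fun z => by
    simp only [p, V, Submodule.coe_orthogonalProjectionOnto_apply,
      Submodule.starProjection_orthogonal_val, Submodule.starProjection_unit_singleton ℝ he1]
  have hpnorm : ∀ z, ‖p z‖ ≤ ‖z‖ := fun z => V.norm_orthogonalProjectionOnto_apply_le z
  have hinorm : ∀ z, |inner ℝ e z| ≤ ‖z‖ := fun z => by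
    simpa [he1] using abs_real_inner_le_norm e z
  have hrank : Module.finrank ℝ V = n - 1 := by
    have h1 := (ℝ ∙ e).finrank_add_finrank_orthogonal
    rw [finrank_span_singleton (by rintro h0; simp [h0] at he1), finrank_euclideanSpace_fin] at h1
    simp only [V]
    omega
  have hvol : (μHE[n - 1] : Measure V) = volume := by
    rw [← hrank]; exact InnerProductSpace.euclideanHausdorffMeasure_eq_volume
  -- the linear map that sends the unit normal to `x₀`
  let T : EuclideanSpace ℝ (Fin n) →L[ℝ] EuclideanSpace ℝ (Fin n) :=
    ContinuousLinearMap.id ℝ _ + (innerSL ℝ e).smulRight (x₀ - e)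
  have hT : ∀ z, T z = z + inner ℝ e z • (x₀ - e) := fun z => by simp [T]
  have hdet : T.det = h₀ := by
    have h1 : (T : _ →ₗ[ℝ] _) = LinearMap.transvection (innerₛₗ ℝ e) (x₀ - e) := by
      ext1 z; simp [LinearMap.transvection, hT]
    rw [ContinuousLinearMap.det, h1, LinearMap.transvection.det]
    simp [inner_sub_right, he1, hh₀]
  -- constants
  obtain ⟨Λ, hΛ1, hΛC⟩ : ∃ Λ : NNReal, 1 < Λ ∧ (Λ : ℝ) ^ (n - 1) < Real.sqrt C := by
    have hc : Tendsto (fun x : ℝ => x ^ (n - 1)) (𝓝[>] 1) (𝓝 1) := by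
      have : Continuous fun x : ℝ => x ^ (n - 1) := by fun_prop
      have h1 := this.tendsto 1
      rw [one_pow] at h1
      exact h1.mono_left nhdsWithin_le_nhds
    obtain ⟨x, hx, hx1⟩ := ((hc.eventually (gt_mem_nhds (Real.lt_sqrt_of_sq_lt
      (by simpa using hC)))).and self_mem_nhdsWithin).exists
    have hx1 : 1 < x := hx1
    exact ⟨⟨x, by linarith⟩, hx1, hx⟩
  have hsC : 1 < Real.sqrt C := Real.lt_sqrt_of_sq_lt (by simpa using hC)
  have hm : ((Real.toNNReal (h₀ / Real.sqrt C) : NNReal) : ENNReal) < ENNReal.ofReal |T.det| := by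
    rw [hdet, abs_of_pos hh₀pos]
    change ENNReal.ofReal _ < _
    rw [ENNReal.ofReal_lt_ofReal_iff hh₀pos]
    exact div_lt_self hh₀pos hsC
  -- τ is the tolerance within which a map approximating T still expands volume by h₀/√C. It is
  -- divided into thirds: flatness κ, patch radius r, height δ.
  obtain ⟨τ, hτ, hτ0⟩ := ((mul_le_addHaar_image_of_lt_det (volume) T hm).and
    self_mem_nhdsWithin).exists
  have hτ0 : (0 : ℝ) < τ := hτ0
  set M := ‖x₀‖ / h₀ with hM
  have hM0 : 0 ≤ M := by positivity
  have hΛ1' : (1 : ℝ) < Λ := hΛ1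
  obtain ⟨κ, hκ, hκΛ, hκτ, hκ2⟩ : ∃ κ : ℝ, 0 < κ ∧ 1 ≤ Λ * (1 - κ * M) ∧ 2 * κ * M ≤ τ / 3 ∧
      κ * M ≤ 1 / 2 := by
    have hc : ∀ a b : ℝ, Tendsto (fun κ : ℝ => a * (b - κ * M)) (𝓝[>] 0) (𝓝 (a * b)) := by
      intro a b
      have : Continuous fun κ : ℝ => a * (b - κ * M) := by fun_prop
      have h1 := this.tendsto 0
      simp only [zero_mul, sub_zero] at h1
      exact h1.mono_left nhdsWithin_le_nhds
    have h1 := (hc Λ 1).eventually (lt_mem_nhds (show (1:ℝ) < Λ * 1 by linarith))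
    have h2 := (hc 2 (τ / 6)).eventually (lt_mem_nhds (show (0:ℝ) < 2 * (τ / 6) by linarith))
    have h3 := (hc 1 (1 / 2)).eventually (lt_mem_nhds (show (0:ℝ) < 1 * (1 / 2) by norm_num))
    obtain ⟨κ, ⟨⟨h1, h2⟩, h3⟩, h4⟩ := (((h1.and h2).and h3).and self_mem_nhdsWithin).exists
    exact ⟨κ, h4, h1.le, by linarith, by linarith⟩
  obtain ⟨r₁, hr₁, hflat⟩ := hν.exists_abs_inner_sub_le hx₀ hκ
  obtain ⟨r, hr, hrr₁, hrτ⟩ : ∃ r : ℝ, 0 < r ∧ r ≤ r₁ ∧ r * (1 + 2 * M) ≤ τ / 3 := by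
    refine ⟨min r₁ (τ / 3 / (1 + 2 * M)), by positivity, min_le_left _ _, ?_⟩
    rw [← le_div_iff₀ (by positivity)]
    exact min_le_right _ _
  obtain ⟨δ, hδ0, hδ1, hδτ⟩ : ∃ δ : ℝ, 0 < δ ∧ δ < 1 ∧ δ ≤ τ / 3 :=
    ⟨min (1 / 2) (τ / 3), by positivity, (min_le_left _ _).trans_lt (by norm_num), min_le_right _ _⟩
  refine ⟨r, hr, δ, ⟨hδ0, hδ1⟩, fun A hA => ?_⟩
  have hA' : A ⊆ frontier K ∩ Metric.ball x₀ r₁ :=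
    hA.trans (inter_subset_inter_right _ (Metric.ball_subset_ball hrr₁))
  -- oblique projection along `x₀`
  set c : EuclideanSpace ℝ (Fin n) → ℝ := fun a => inner ℝ e a / h₀ with hc
  have hcsub : ∀ a b, c a - c b = inner ℝ e (a - b) / h₀ := fun a b => by
    simp only [hc, inner_sub_right]; ring
  set q : EuclideanSpace ℝ (Fin n) → V := fun a => p (a - c a • x₀) with hq
  have hqval : ∀ a, (q a : EuclideanSpace ℝ (Fin n)) = a - c a • x₀ := fun a => by
    rw [hq, hp, inner_sub_right, inner_smul_right, ← hh₀, hc]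
    simp [div_mul_cancel₀ _ hh₀pos.ne']
  have hcle : ∀ a ∈ A, ∀ b ∈ A, |c a - c b| * ‖x₀‖ ≤ κ * M * ‖a - b‖ := by
    intro a ha b hb
    rw [hcsub, abs_div, abs_of_pos hh₀pos, hM]
    have := hflat a (hA' ha) b (hA' hb)
    calc |inner ℝ e (a - b)| / h₀ * ‖x₀‖ ≤ κ * ‖a - b‖ / h₀ * ‖x₀‖ := by gcongr
      _ = κ * (‖x₀‖ / h₀) * ‖a - b‖ := by ring
  have hqanti : ∀ a ∈ A, ∀ b ∈ A, (1 - κ * M) * ‖a - b‖ ≤ ‖q a - q b‖ := by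
    intro a ha b hb
    have h1 : a - b = ((q a - q b : V) : EuclideanSpace ℝ (Fin n)) + (c a - c b) • x₀ := by
      rw [Submodule.coe_sub, hqval, hqval]; module
    have h2 : ‖a - b‖ ≤ ‖q a - q b‖ + |c a - c b| * ‖x₀‖ := by
      conv_lhs => rw [h1]
      refine (norm_add_le _ _).trans ?_
      rw [norm_smul, Real.norm_eq_abs, Submodule.coe_norm]
    have := hcle a ha b hb
    linarith
  have hqinj : InjOn q A := by
    intro a ha b hb hab
    have h1 := hqanti a ha b hb
    rw [hab, sub_self, norm_zero] at h1
    have : ‖a - b‖ ≤ 0 := by nlinarith [norm_nonneg (a - b)]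
    exact sub_eq_zero.1 (norm_le_zero_iff.1 this)
  set B := q '' A with hB
  set i : V → EuclideanSpace ℝ (Fin n) := Function.invFunOn q A with hi
  have hiA : ∀ a ∈ A, i (q a) = a := fun a ha => hqinj.leftInvOn_invFunOn ha
  have hiB : i '' B = A := by
    rw [hB, image_image]
    exact (image_congr hiA).trans (image_id _)
  have hLip : LipschitzOnWith Λ i B := by
    refine LipschitzOnWith.of_dist_le_mul ?_
    rintro _ ⟨a, ha, rfl⟩ _ ⟨b, hb, rfl⟩
    rw [hiA a ha, hiA b hb, dist_eq_norm, dist_eq_norm]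
    have h1 := hqanti a ha b hb
    calc ‖a - b‖ ≤ Λ * (1 - κ * M) * ‖a - b‖ := le_mul_of_one_le_left (norm_nonneg _) hκΛ
      _ = Λ * ((1 - κ * M) * ‖a - b‖) := by ring
      _ ≤ Λ * ‖q a - q b‖ := by gcongr
  have hHaus : μHE[n - 1] A ≤ ENNReal.ofReal (Real.sqrt C) * volume B := by
    rw [← hvol]
    calc μHE[n - 1] A = μHE[n - 1] (i '' B) := by rw [hiB]
      _ ≤ (Λ : ENNReal) ^ (n - 1) * μHE[n - 1] B := euclideanHausdorffMeasure_image_le hLip _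
      _ ≤ _ := by
        gcongr
        rw [← ENNReal.coe_pow, ENNReal.le_ofReal_iff_toReal_le (by simp) (by positivity)]
        simpa using hΛC.le
  -- the cylinder and the map onto the shell
  set D := {z : EuclideanSpace ℝ (Fin n) | inner ℝ e z ∈ Ioc (1 - δ) 1 ∧ p z ∈ B} with hD
  have hDvol : volume D = ENNReal.ofReal δ * volume B := by
    rw [hD, volume_cylinder he1, Real.volume_Ioc]
    congr 2; ring
  set Ψ : EuclideanSpace ℝ (Fin n) → EuclideanSpace ℝ (Fin n) :=
    fun z => inner ℝ e z • i (p z) with hΨ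
  have hΨim : Ψ '' D ⊆ coneShell K A δ := by
    rintro _ ⟨z, ⟨hz, a, ha, haz⟩, rfl⟩
    have hs0 : 0 < inner ℝ e z := by linarith [hz.1]
    have hg : gauge K (Ψ z) = inner ℝ e z := by
      simp only [hΨ]
      rw [← haz, hiA a ha, gauge_smul_of_nonneg hs0.le, hν.gauge_eq_one (hA ha).1]
      simp
    refine ⟨by rw [hg]; exact hz.1, by rw [hg]; exact hz.2, ?_⟩
    rw [hg]
    simp only [hΨ]
    rw [← haz, hiA a ha, smul_smul, inv_mul_cancel₀ hs0.ne', one_smul]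
    exact ha
  have hcx₀ : c x₀ = 1 := by simp only [hc]; exact div_self hh₀pos.ne'
  have hc1 : ∀ a ∈ A, |c a - 1| * ‖x₀‖ ≤ r * M := by
    intro a ha
    have h0 : ‖a - x₀‖ ≤ r := by
      rw [← dist_eq_norm]; exact (Metric.mem_ball.1 (hA ha).2).le
    rw [← hcx₀, hcsub, abs_div, abs_of_pos hh₀pos, hM]
    calc |inner ℝ e (a - x₀)| / h₀ * ‖x₀‖ ≤ r / h₀ * ‖x₀‖ := by
          gcongr; exact (hinorm _).trans h0
      _ = r * (‖x₀‖ / h₀) := by ring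
  have hqr : ∀ a ∈ A, ‖q a‖ ≤ r * (1 + M) := by
    intro a ha
    have h0 : ‖a - x₀‖ ≤ r := by
      rw [← dist_eq_norm]; exact (Metric.mem_ball.1 (hA ha).2).le
    have h1 : (q a : EuclideanSpace ℝ (Fin n)) = (a - x₀) - (c a - 1) • x₀ := by
      rw [hqval]; module
    rw [Submodule.coe_norm, h1]
    refine (norm_sub_le _ _).trans ?_
    rw [norm_smul, Real.norm_eq_abs]
    linarith [hc1 a ha]
  have happrox : ApproximatesLinearOn Ψ T D τ := by
    rintro z ⟨hz, a, ha, haz⟩ w ⟨hw, b, hb, hbw⟩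
    set s := inner ℝ e z with hs
    set t := inner ℝ e w with ht
    have hst : |s - t| ≤ ‖z - w‖ := by
      rw [hs, ht, ← inner_sub_right]; exact hinorm _
    have hyy : ‖q a - q b‖ ≤ ‖z - w‖ := by
      rw [haz, hbw, ← map_sub]; exact hpnorm _
    -- The four error terms are small for different reasons: |s - 1| ≤ δ, q b is of size r, c a is
    -- close to 1 near x₀, and c varies little by flatness.
    have h1 : Ψ z - Ψ w - T (z - w) = (s - 1) • ((q a - q b : V) : EuclideanSpace ℝ (Fin n))
        + (s - t) • ((q b : V) : EuclideanSpace ℝ (Fin n)) + (s - t) • (c a - 1) • x₀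
        + t • (c a - c b) • x₀ := by
      simp only [hΨ]
      rw [← haz, ← hbw, hiA a ha, hiA b hb, hT, inner_sub_right, ← hs, ← ht]
      have hz' : z = (q a : EuclideanSpace ℝ (Fin n)) + s • e := by rw [haz, hp]; simp [hs]
      have hw' : w = (q b : EuclideanSpace ℝ (Fin n)) + t • e := by rw [hbw, hp]; simp [ht]
      have ha' : a = (q a : EuclideanSpace ℝ (Fin n)) + c a • x₀ := by rw [hqval]; simp
      have hb' : b = (q b : EuclideanSpace ℝ (Fin n)) + c b • x₀ := by rw [hqval]; simp
      calc s • a - t • b - (z - w + (s - t) • (x₀ - e))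
          = s • ((q a : EuclideanSpace ℝ (Fin n)) + c a • x₀)
            - t • ((q b : EuclideanSpace ℝ (Fin n)) + c b • x₀)
            - (((q a : EuclideanSpace ℝ (Fin n)) + s • e)
              - ((q b : EuclideanSpace ℝ (Fin n)) + t • e) + (s - t) • (x₀ - e)) := by
            rw [← ha', ← hb', ← hz', ← hw']
        _ = _ := by rw [Submodule.coe_sub]; module
    rw [h1]
    have e1 : ‖(s - 1) • ((q a - q b : V) : EuclideanSpace ℝ (Fin n))‖ ≤ δ * ‖z - w‖ := by
      rw [norm_smul, Real.norm_eq_abs, ← Submodule.coe_norm]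
      have : |s - 1| ≤ δ := by rw [abs_le]; constructor <;> linarith [hz.1, hz.2]
      gcongr
    have e2 : ‖(s - t) • ((q b : V) : EuclideanSpace ℝ (Fin n))‖ ≤ ‖z - w‖ * (r * (1 + M)) := by
      rw [norm_smul, Real.norm_eq_abs, ← Submodule.coe_norm]
      gcongr
      exact hqr b hb
    have e3 : ‖(s - t) • (c a - 1) • x₀‖ ≤ ‖z - w‖ * (r * M) := by
      rw [norm_smul, norm_smul, Real.norm_eq_abs, Real.norm_eq_abs]
      exact mul_le_mul hst (hc1 a ha) (by positivity) (norm_nonneg _)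
    have e4 : ‖t • (c a - c b) • x₀‖ ≤ 2 * κ * M * ‖z - w‖ := by
      rw [norm_smul, norm_smul, Real.norm_eq_abs, Real.norm_eq_abs]
      have ht1 : |t| ≤ 1 := by rw [abs_le]; constructor <;> linarith [hw.1, hw.2]
      have h2 := hcle a ha b hb
      have h3 := hqanti a ha b hb
      have h4 : ‖a - b‖ ≤ 2 * ‖z - w‖ := by nlinarith [norm_nonneg (a - b)]
      calc |t| * (|c a - c b| * ‖x₀‖) ≤ 1 * (|c a - c b| * ‖x₀‖) := by gcongr
        _ ≤ κ * M * ‖a - b‖ := by rw [one_mul]; exact h2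
        _ ≤ κ * M * (2 * ‖z - w‖) := by gcongr
        _ = _ := by ring
    refine norm_add₄_le.trans ((add_le_add (add_le_add (add_le_add e1 e2) e3) e4).trans ?_)
    calc δ * ‖z - w‖ + ‖z - w‖ * (r * (1 + M)) + ‖z - w‖ * (r * M) + 2 * κ * M * ‖z - w‖
        = (δ + r * (1 + 2 * M) + 2 * κ * M) * ‖z - w‖ := by ring
      _ ≤ τ * ‖z - w‖ := by gcongr; linarith
  have hmain := hτ D Ψ happrox
  change ENNReal.ofReal _ * _ ≤ _ at hmain
  rw [hDvol] at hmain
  have hsC0 : (0:ℝ) ≤ Real.sqrt C := Real.sqrt_nonneg _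
  calc ENNReal.ofReal (h₀ * δ) * μHE[n - 1] A
      ≤ ENNReal.ofReal (h₀ * δ) * (ENNReal.ofReal (Real.sqrt C) * volume B) := by gcongr
    _ = ENNReal.ofReal C * (ENNReal.ofReal (h₀ / Real.sqrt C) *
        (ENNReal.ofReal δ * volume B)) := by
      have : h₀ * δ * Real.sqrt C = C * (h₀ / Real.sqrt C) * δ := by
        have h1 : Real.sqrt C * Real.sqrt C = C := Real.mul_self_sqrt (by linarith)
        have h2 : Real.sqrt C ≠ 0 := by positivity
        field_simp
        rw [sq, h1]
      rw [← mul_assoc, ← ENNReal.ofReal_mul (by positivity), this, ENNReal.ofReal_mul (by positivity),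
        ENNReal.ofReal_mul (by linarith)]
      ring
    _ ≤ ENNReal.ofReal C * volume (coneShell K A δ) := by
      gcongr
      exact hmain.trans (measure_mono hΨim)

end IsNormalField

/-! ### The surface integral is at most n times the measure -/

namespace IsNormalField

variable {K : Set (EuclideanSpace ℝ (Fin n))}
  {ν : EuclideanSpace ℝ (Fin n) → EuclideanSpace ℝ (Fin n)} (hν : IsNormalField K ν)
include hν

theorem continuous_gauge : Continuous (gauge K) :=
  _root_.continuous_gauge hν.convex hν.mem_nhds

theorem measurableSet_coneShell {A : Set (EuclideanSpace ℝ (Fin n))} (hA : MeasurableSet A)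
    (δ : ℝ) : MeasurableSet (coneShell K A δ) := by
  have hg := hν.continuous_gauge.measurable
  exact (measurableSet_lt measurable_const hg).inter ((measurableSet_le hg measurable_const).inter
    ((hg.inv.smul measurable_id) hA))

theorem coneShell_subset (A : Set (EuclideanSpace ℝ (Fin n))) (δ : ℝ) : coneShell K A δ ⊆ K := by
  rintro x ⟨-, hx, -⟩
  have := mem_closure_of_gauge_le_one hν.convex (mem_of_mem_nhds hν.mem_nhds)
    (absorbent_nhds_zero hν.mem_nhds) hx
  rwa [hν.isCompact.isClosed.closure_eq] at this

/-- The cone is the disjoint union of the shell and its own dilate by 1 - δ, so the shell has the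
fraction 1 - (1 - δ)ⁿ of the volume, at most nδ by Bernoulli. -/
theorem volume_coneShell_le {A : Set (EuclideanSpace ℝ (Fin n))} (hA : MeasurableSet A) {δ : ℝ}
    (hδ : δ ∈ Ioo (0 : ℝ) 1) :
    volume (coneShell K A δ) ≤ ENNReal.ofReal (n * δ) * volume (coneShell K A 1) := by
  have hδ' : 0 < 1 - δ := by linarith [hδ.2]
  have hmem : ∀ x, x ∈ (1 - δ) • coneShell K A 1 ↔
      0 < gauge K x ∧ gauge K x ≤ 1 - δ ∧ (gauge K x)⁻¹ • x ∈ A := by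
    intro x
    rw [mem_smul_set_iff_inv_smul_mem₀ hδ'.ne']
    simp only [coneShell, mem_ofPred_eq, sub_self,
      gauge_smul_of_nonneg (inv_nonneg.2 hδ'.le), smul_eq_mul, mul_inv, inv_inv, smul_smul]
    rw [mul_right_comm, mul_inv_cancel₀ hδ'.ne', one_mul, inv_mul_le_iff₀ hδ', mul_one,
      mul_pos_iff_of_pos_left (inv_pos.2 hδ')]
  have hunion : coneShell K A 1 = coneShell K A δ ∪ (1 - δ) • coneShell K A 1 := by
    ext x
    rw [mem_union, hmem]
    simp only [coneShell, mem_ofPred_eq, sub_self]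
    constructor
    · rintro ⟨h1, h2, h3⟩
      rcases lt_or_ge (1 - δ) (gauge K x) with h | h
      · exact Or.inl ⟨h, h2, h3⟩
      · exact Or.inr ⟨h1, h, h3⟩
    · rintro (⟨h1, h2, h3⟩ | ⟨h1, h2, h3⟩)
      · exact ⟨hδ'.trans h1, h2, h3⟩
      · exact ⟨h1, by linarith [hδ.1], h3⟩
  have hdisj : Disjoint (coneShell K A δ) ((1 - δ) • coneShell K A 1) := by
    rw [Set.disjoint_left]
    intro x hx hx'
    exact absurd ((hmem x).1 hx').2.1 (not_le.2 hx.1)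
  set v := volume (coneShell K A 1) with hv
  have hvfin : v ≠ ⊤ :=
    ((measure_mono (hν.coneShell_subset A 1)).trans_lt hν.isCompact.measure_lt_top).ne
  have h1 : v = volume (coneShell K A δ) + ENNReal.ofReal ((1 - δ) ^ n) * v := by
    conv_lhs => rw [hv, hunion]
    rw [measure_union hdisj ((hν.measurableSet_coneShell hA 1).const_smul₀ _), Measure.addHaar_smul,
      finrank_euclideanSpace_fin, abs_of_pos (by positivity)]
  have hfin : ENNReal.ofReal ((1 - δ) ^ n) * v ≠ ⊤ := ENNReal.mul_ne_top ENNReal.ofReal_ne_top hvfin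
  refine (ENNReal.add_le_add_iff_right hfin).1 ?_
  rw [← h1, ← add_mul, ← ENNReal.ofReal_add (mul_nonneg n.cast_nonneg hδ.1.le) (by positivity)]
  refine le_mul_of_one_le_left zero_le ?_
  rw [ENNReal.one_le_ofReal]
  have := one_add_mul_le_pow (a := -δ) (by linarith [hδ.2]) n
  rw [← sub_eq_add_neg] at this
  linarith

variable {u : EuclideanSpace ℝ (Fin n) → ℝ} (hu : Continuous u)
  (hu_mono : ∀ s ∈ Icc (0 : ℝ) 1, ∀ x, u (s • x) ≤ u x)
include hu hu_mono

omit hu in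
-- A point of the cone is a contraction of its radial projection in A, so u there is at most U.
theorem ofReal_mul_volume_le {A : Set (EuclideanSpace ℝ (Fin n))} (hA : MeasurableSet A) {U : ℝ}
    (hU : ∀ a ∈ A, u a ≤ U) :
    ENNReal.ofReal (Real.exp (-U)) * volume (coneShell K A 1) ≤ expMeasure u (coneShell K A 1) := by
  have hm := hν.measurableSet_coneShell hA 1
  rw [expMeasure, withDensity_apply _ hm, ← setLIntegral_const]
  refine setLIntegral_mono' hm fun x hx => ENNReal.ofReal_le_ofReal (Real.exp_le_exp.2 ?_)
  obtain ⟨h1, h2, h3⟩ := hx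
  rw [sub_self] at h1
  have h4 := hu_mono _ ⟨h1.le, h2⟩ ((gauge K x)⁻¹ • x)
  rw [smul_smul, mul_inv_cancel₀ h1.ne', one_smul] at h4
  linarith [hU _ h3]

/-- One factor C pays for the oscillation of the integrand on the patch, one for the oscillation of
u (at most log C above u(x₀)), one for the shell estimate. The shell width δ cancels. -/
theorem exists_lintegral_le_cone {x₀ : EuclideanSpace ℝ (Fin n)} (hx₀ : x₀ ∈ frontier K) {C : ℝ}
    (hC : 1 < C) : ∃ r > 0, ∀ A ⊆ frontier K ∩ Metric.ball x₀ r, MeasurableSet A →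
      ∫⁻ x in A, ENNReal.ofReal (inner ℝ (ν x) x * Real.exp (-u x)) ∂μHE[n - 1] ≤
        ENNReal.ofReal (C ^ 3 * n) * expMeasure u (coneShell K A 1) := by
  obtain ⟨r₁, hr₁, δ, hδ, hsh⟩ := hν.exists_surface_le_shell hx₀ hC
  have hC0 : 0 < C := by linarith
  have hp := hν.inner_pos hx₀
  set h₀ := inner ℝ (ν x₀) x₀ with hh₀
  have hcont : ContinuousWithinAt (fun x => inner ℝ (ν x) x * Real.exp (-u x)) (frontier K) x₀ :=
    (((hν.continuousOn.inner continuousOn_id).mul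
      (Real.continuous_exp.comp hu.neg).continuousOn)) x₀ hx₀
  have hpe : 0 < h₀ * Real.exp (-u x₀) := mul_pos hp (Real.exp_pos _)
  have h1 := hcont.eventually (gt_mem_nhds (lt_mul_of_one_lt_left hpe hC))
  have h2 : ∀ᶠ x in 𝓝[frontier K] x₀, u x < u x₀ + Real.log C :=
    hu.continuousWithinAt.eventually (gt_mem_nhds (by linarith [Real.log_pos hC]))
  obtain ⟨r₂, hr₂, hb⟩ := Metric.mem_nhdsWithin_iff.1 (h1.and h2)
  refine ⟨min r₁ r₂, lt_min hr₁ hr₂, fun A hA hAm => ?_⟩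
  have hA₁ : A ⊆ frontier K ∩ Metric.ball x₀ r₁ :=
    hA.trans (inter_subset_inter_right _ (Metric.ball_subset_ball (min_le_left _ _)))
  have hA₂ : ∀ a ∈ A, inner ℝ (ν a) a * Real.exp (-u a) < C * (h₀ * Real.exp (-u x₀)) ∧
      u a < u x₀ + Real.log C := fun a ha =>
    hb ⟨Metric.ball_subset_ball (min_le_right _ _) (hA ha).2, (hA ha).1⟩
  have e1 : ∫⁻ x in A, ENNReal.ofReal (inner ℝ (ν x) x * Real.exp (-u x)) ∂μHE[n - 1] ≤
      ENNReal.ofReal (C * (h₀ * Real.exp (-u x₀))) * μHE[n - 1] A := by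
    rw [← setLIntegral_const]
    exact setLIntegral_mono' hAm fun x hx => ENNReal.ofReal_le_ofReal (hA₂ x hx).1.le
  have e2 := hsh A hA₁
  have e3 := hν.volume_coneShell_le hAm hδ
  have e4 := hν.ofReal_mul_volume_le hu_mono hAm (fun a ha => (hA₂ a ha).2.le)
  have hexp : Real.exp (-u x₀) = C * Real.exp (-(u x₀ + Real.log C)) := by
    rw [neg_add, Real.exp_add, Real.exp_neg (Real.log C), Real.exp_log hC0]
    field_simp
  set E := Real.exp (-(u x₀ + Real.log C)) with hE
  have hE0 : 0 < E := Real.exp_pos _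
  have hδ0 := hδ.1
  calc _ ≤ ENNReal.ofReal (C * (h₀ * Real.exp (-u x₀))) * μHE[n - 1] A := e1
    _ = ENNReal.ofReal (C * C * E / δ) * (ENNReal.ofReal (h₀ * δ) * μHE[n - 1] A) := by
      rw [← mul_assoc (ENNReal.ofReal (C * C * E / δ)), ← ENNReal.ofReal_mul (by positivity), hexp]
      congr 2
      field_simp
    _ ≤ ENNReal.ofReal (C * C * E / δ) * (ENNReal.ofReal C *
        (ENNReal.ofReal (n * δ) * volume (coneShell K A 1))) := by
      refine mul_le_mul_right (e2.trans ?_) _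
      gcongr
    _ = ENNReal.ofReal (C ^ 3 * n) * (ENNReal.ofReal E * volume (coneShell K A 1)) := by
      simp only [← mul_assoc]
      rw [← ENNReal.ofReal_mul (by positivity), ← ENNReal.ofReal_mul (by positivity),
        ← ENNReal.ofReal_mul (by positivity)]
      congr 2
      field_simp
    _ ≤ _ := by gcongr

/-- The surface integral of the support function is at most `n` times the measure of the body. -/
theorem lintegral_frontier_le :
    ∫⁻ x in frontier K, ENNReal.ofReal (inner ℝ (ν x) x * Real.exp (-u x)) ∂μHE[n - 1] ≤
      n * expMeasure u K := by
  have hKc : IsCompact (frontier K) :=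
    hν.isCompact.of_isClosed_subset isClosed_frontier hν.frontier_subset
  have key : ∀ C : ℝ, 1 < C →
      ∫⁻ x in frontier K, ENNReal.ofReal (inner ℝ (ν x) x * Real.exp (-u x)) ∂μHE[n - 1] ≤
        ENNReal.ofReal (C ^ 3 * n) * expMeasure u K := by
    intro C hC
    -- The bound is asked of all measurable subsets of B so that compactness induction can split A
    -- into A ∩ B₁ and A \ B₁, whose cones are disjoint and hence have additive measure.
    have hind : ∃ B, MeasurableSet B ∧ frontier K ⊆ B ∧ ∀ A ⊆ frontier K ∩ B, MeasurableSet A →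
        ∫⁻ x in A, ENNReal.ofReal (inner ℝ (ν x) x * Real.exp (-u x)) ∂μHE[n - 1] ≤
        ENNReal.ofReal (C ^ 3 * n) * expMeasure u (coneShell K A 1) := by
      refine hKc.induction_on (p := fun S => ∃ B, MeasurableSet B ∧ S ⊆ B ∧
        ∀ A ⊆ frontier K ∩ B, MeasurableSet A →
        ∫⁻ x in A, ENNReal.ofReal (inner ℝ (ν x) x * Real.exp (-u x)) ∂μHE[n - 1] ≤
        ENNReal.ofReal (C ^ 3 * n) * expMeasure u (coneShell K A 1)) ?_ ?_ ?_ ?_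
      · refine ⟨∅, MeasurableSet.empty, subset_rfl, fun A hA _ => ?_⟩
        have : A = ∅ := by simpa using hA
        simp [this]
      · rintro s t hst ⟨B, hB, htB, h⟩
        exact ⟨B, hB, hst.trans htB, h⟩
      · rintro s t ⟨B₁, hB₁, hs, h₁⟩ ⟨B₂, hB₂, ht, h₂⟩
        refine ⟨B₁ ∪ B₂, hB₁.union hB₂, union_subset_union hs ht, fun A hA hAm => ?_⟩
        have i1 := h₁ (A ∩ B₁) (fun x hx => ⟨(hA hx.1).1, hx.2⟩) (hAm.inter hB₁)
        have i2 := h₂ (A \ B₁) (fun x hx => ⟨(hA hx.1).1, (hA hx.1).2.resolve_left hx.2⟩)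
          (hAm.diff hB₁)
        rw [← lintegral_inter_add_sdiff _ A hB₁]
        refine (add_le_add i1 i2).trans ?_
        rw [← mul_add, ← measure_union _ (hν.measurableSet_coneShell (hAm.diff hB₁) 1)]
        · gcongr
          rintro x (hx | hx)
          · exact ⟨hx.1, hx.2.1, hx.2.2.1⟩
          · exact ⟨hx.1, hx.2.1, hx.2.2.1⟩
        · rw [Set.disjoint_left]
          exact fun x hx hx' => hx'.2.2.2 hx.2.2.2
      · intro x hx
        obtain ⟨r, hr, h⟩ := hν.exists_lintegral_le_cone hu hu_mono hx hC
        exact ⟨Metric.ball x r, mem_nhdsWithin_of_mem_nhds (Metric.ball_mem_nhds x hr),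
          Metric.ball x r, measurableSet_ball, subset_rfl, h⟩
    obtain ⟨B, -, hB, h⟩ := hind
    refine (h (frontier K) (subset_inter subset_rfl hB) isClosed_frontier.measurableSet).trans ?_
    gcongr
    exact hν.coneShell_subset _ _
  have hlim : Tendsto (fun C : ℝ => ENNReal.ofReal (C ^ 3 * n) * expMeasure u K) (𝓝[>] 1)
      (𝓝 (n * expMeasure u K)) := by
    rcases Nat.eq_zero_or_pos n with rfl | hn
    · simp
    refine ENNReal.Tendsto.mul_const ?_ (Or.inl (by simpa using hn.ne'))
    have hc : Continuous fun C : ℝ => ENNReal.ofReal (C ^ 3 * n) :=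
      ENNReal.continuous_ofReal.comp (by fun_prop)
    have h1 := hc.tendsto 1
    simp only [one_pow, one_mul, ENNReal.ofReal_natCast] at h1
    exact h1.mono_left nhdsWithin_le_nhds
  exact ge_of_tendsto hlim (eventually_nhdsWithin_of_forall key)

omit hu hu_mono in
/-- The boundary of a convex body has positive surface measure. -/
theorem euclideanHausdorffMeasure_frontier_pos (hn : 1 ≤ n) : 0 < μHE[n - 1] (frontier K) := by
  obtain ⟨e, he1⟩ : ∃ e : EuclideanSpace ℝ (Fin n), ‖e‖ = 1 :=
    ⟨EuclideanSpace.single ⟨0, hn⟩ 1, by simp⟩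
  set V := (ℝ ∙ e)ᗮ with hV
  have hrank : Module.finrank ℝ V = n - 1 := by
    have h1 := (ℝ ∙ e).finrank_add_finrank_orthogonal
    rw [finrank_span_singleton (by rintro h0; simp [h0] at he1), finrank_euclideanSpace_fin] at h1
    simp only [V]
    omega
  have hvol : (μHE[n - 1] : Measure V) = volume := by
    rw [← hrank]; exact InnerProductSpace.euclideanHausdorffMeasure_eq_volume
  -- A line parallel to e through an interior point of the section leaves the bounded set K, so its
  -- gauge takes the value 1. The projection being 1-Lipschitz, the boundary has at least the area
  -- of this open section.
  have hsub : ((↑) : V → EuclideanSpace ℝ (Fin n)) ⁻¹' interior K ⊆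
      V.orthogonalProjectionOnto '' frontier K := by
    intro v hv
    obtain ⟨R, hR⟩ := hν.isCompact.isBounded.exists_norm_le
    set f : ℝ → EuclideanSpace ℝ (Fin n) := fun s => v + s • e with hf
    have hlarge : 1 ≤ gauge K (f (R + 1 + ‖v‖)) := by
      refine one_le_gauge_of_notMem (hν.convex.starConvex (mem_of_mem_nhds hν.mem_nhds))
        ((absorbent_nhds_zero hν.mem_nhds) _) fun hmem => ?_
      have h1 := hR _ hmem
      have hR0 : 0 ≤ R := (norm_nonneg _).trans h1
      have h2 := norm_sub_le (f (R + 1 + ‖v‖)) v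
      rw [hf, add_sub_cancel_left, norm_smul, he1, mul_one, Real.norm_eq_abs,
        abs_of_nonneg (by positivity), ← Submodule.coe_norm] at h2
      linarith
    obtain ⟨s, hs⟩ := mem_range_of_exists_le_of_exists_ge
      (f := fun s => gauge K (f s)) (hν.continuous_gauge.comp (by fun_prop))
      ⟨0, by simpa [hf] using gauge_le_one_of_mem (interior_subset hv)⟩ ⟨_, hlarge⟩
    refine ⟨f s, (gauge_eq_one_iff_mem_frontier hν.convex hν.mem_nhds).1 hs, ?_⟩
    have he0 : V.orthogonalProjectionOnto e = 0 :=
      Submodule.orthogonalProjectionOnto_eq_zero_iff.2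
        (Submodule.le_orthogonal_orthogonal _ (Submodule.mem_span_singleton_self e))
    rw [hf, map_add, map_smul, he0, smul_zero, add_zero]
    exact Submodule.orthogonalProjectionOnto_mem_subspace_eq_self v
  have hopen : 0 < volume (((↑) : V → EuclideanSpace ℝ (Fin n)) ⁻¹' interior K) :=
    (isOpen_interior.preimage continuous_subtype_val).measure_pos _
      ⟨0, mem_interior_iff_mem_nhds.2 hν.mem_nhds⟩
  have hLip : LipschitzOnWith 1 V.orthogonalProjectionOnto (frontier K) :=
    V.lipschitzWith_orthogonalProjectionOnto.lipschitzOnWith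
  have hle := euclideanHausdorffMeasure_image_le hLip (n - 1)
  rw [hvol] at hle
  simpa using (hopen.trans_le (measure_mono hsub)).trans_le hle

end IsNormalField

/-! ### The measure with density e^{-u} and its radial monotonicity -/

theorem smul_le_of_even_of_convexOn {u : EuclideanSpace ℝ (Fin n) → ℝ} (hu_even : Function.Even u)
    (hu_convex : ConvexOn ℝ univ u) (s : ℝ) (hs : s ∈ Icc (0 : ℝ) 1)
    (x : EuclideanSpace ℝ (Fin n)) : u (s • x) ≤ u x := by
  -- s • x is the combination of x and -x with weights (1 ± s)/2, and u agrees at both.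
  have h1 := hu_convex.2 (mem_univ x) (mem_univ (-x)) (show 0 ≤ (1 + s) / 2 by linarith [hs.1])
    (show 0 ≤ (1 - s) / 2 by linarith [hs.2]) (by ring)
  rw [hu_even x] at h1
  have h2 : ((1 + s) / 2) • x + ((1 - s) / 2) • -x = s • x := by module
  rw [h2, smul_eq_mul, smul_eq_mul] at h1
  linarith

theorem expMeasure_lt_top {u : EuclideanSpace ℝ (Fin n) → ℝ} (hu : Continuous u)
    {K : Set (EuclideanSpace ℝ (Fin n))} (hK : IsCompact K) : expMeasure u K < ⊤ := by
  have : IsLocallyFiniteMeasure (expMeasure u) :=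
    IsLocallyFiniteMeasure.withDensity_ofReal (Real.continuous_exp.comp hu.neg)
  exact hK.measure_lt_top

theorem expMeasure_pos {u : EuclideanSpace ℝ (Fin n) → ℝ} (hu : Continuous u)
    {K : Set (EuclideanSpace ℝ (Fin n))} (hK : K ∈ 𝓝 0) : 0 < expMeasure u K := by
  have h1 : 0 < expMeasure u (interior K) := by
    rw [expMeasure, withDensity_apply _ isOpen_interior.measurableSet]
    rw [setLIntegral_pos_iff (by fun_prop)]
    have : Function.support (fun x => ENNReal.ofReal (Real.exp (-u x))) = univ := by
      ext x; simp [Real.exp_pos]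
    rw [this, univ_inter]
    exact isOpen_interior.measure_pos _ ⟨0, mem_interior_iff_mem_nhds.2 hK⟩
  exact h1.trans_le (measure_mono interior_subset)

/-- Change of variables x ↦ c • x, under which the density does not decrease. It substitutes for
continuity of the measure near degenerate situations. -/
theorem ofReal_pow_mul_expMeasure_le {u : EuclideanSpace ℝ (Fin n) → ℝ}
    (hu_mono : ∀ s ∈ Icc (0 : ℝ) 1, ∀ x, u (s • x) ≤ u x) {c : ℝ} (hc : c ∈ Ioc (0 : ℝ) 1)
    (K : Set (EuclideanSpace ℝ (Fin n))) :
    ENNReal.ofReal (c ^ n) * expMeasure u K ≤ expMeasure u (c • K) := by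
  have hc0 : c ≠ 0 := hc.1.ne'
  have hemb : MeasurableEmbedding fun x : EuclideanSpace ℝ (Fin n) => c • x :=
    measurableEmbedding_const_smul₀ hc0
  have hmap := Measure.map_addHaar_smul (volume : Measure (EuclideanSpace ℝ (Fin n))) hc0
  have hvol : (volume : Measure (EuclideanSpace ℝ (Fin n))) =
      ENNReal.ofReal (c ^ n) • Measure.map (fun x => c • x) volume := by
    have h1 : Measure.map (fun x : EuclideanSpace ℝ (Fin n) => c • x) volume =
      ENNReal.ofReal |(c ^ Module.finrank ℝ (EuclideanSpace ℝ (Fin n)))⁻¹| • volume := hmap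
    have hp : 0 < c ^ n := pow_pos hc.1 n
    rw [h1, smul_smul, finrank_euclideanSpace_fin, abs_of_pos (inv_pos.2 hp),
      ← ENNReal.ofReal_mul hp.le, mul_inv_cancel₀ hp.ne']
    simp
  have hpre : (fun x : EuclideanSpace ℝ (Fin n) => c • x) ⁻¹' (c • K) = K :=
    preimage_image_eq _ hemb.injective
  rw [expMeasure, withDensity_apply', withDensity_apply']
  conv_rhs => rw [hvol]
  rw [Measure.restrict_smul, lintegral_smul_measure, hemb.restrict_map, hemb.lintegral_map, hpre,
    smul_eq_mul]
  gcongr with x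
  exact hu_mono c ⟨hc.1.le, hc.2⟩ x

theorem IsSmoothNorm.boundarySupportIntegral_eq {h : EuclideanSpace ℝ (Fin n) → ℝ}
    (hh : IsSmoothNorm h) {u : EuclideanSpace ℝ (Fin n) → ℝ} (hu : Continuous u) :
    boundarySupportIntegral u (wulff h) =
      (∫⁻ x in frontier (wulff h), ENNReal.ofReal
        (inner ℝ (gaussMap (wulff h) x) x * Real.exp (-u x)) ∂μHE[n - 1]).toReal := by
  have hm : MeasurableSet (frontier (wulff h)) := isClosed_frontier.measurableSet
  have h1 : boundarySupportIntegral u (wulff h) =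
      ∫ x in frontier (wulff h), inner ℝ (gaussMap (wulff h) x) x * Real.exp (-u x) ∂μHE[n - 1] := by
    refine setIntegral_congr_fun hm fun x hx => ?_
    have h2 := hh.gaussMap_spec hx
    rw [hh.supportFun_wulff (by intro h0; rw [h0] at h2; simp at h2), h2.2]
  rw [h1]
  refine integral_eq_lintegral_of_nonneg_ae ?_ ?_
  · filter_upwards [ae_restrict_mem hm] with x hx
    exact mul_nonneg (hh.isNormalField.inner_pos hx).le (Real.exp_pos _).le
  · exact ((hh.continuousOn_gaussMap.inner continuousOn_id).mul
      (Real.continuous_exp.comp hu.neg).continuousOn).aestronglyMeasurable hm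

theorem IsSmoothNorm.boundarySupportIntegral_le {h : EuclideanSpace ℝ (Fin n) → ℝ}
    (hh : IsSmoothNorm h) {u : EuclideanSpace ℝ (Fin n) → ℝ} (hu : Continuous u)
    (hu_mono : ∀ s ∈ Icc (0 : ℝ) 1, ∀ x, u (s • x) ≤ u x) :
    boundarySupportIntegral u (wulff h) ≤ n * (expMeasure u).real (wulff h) := by
  rw [hh.boundarySupportIntegral_eq hu]
  have h1 := ENNReal.toReal_mono
    (ENNReal.mul_ne_top (ENNReal.natCast_ne_top n) (expMeasure_lt_top hu hh.isCompact_wulff).ne)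
    (hh.isNormalField.lintegral_frontier_le hu hu_mono)
  rwa [ENNReal.toReal_mul, ENNReal.toReal_natCast] at h1

theorem IsSmoothNorm.boundarySupportIntegral_pos {h : EuclideanSpace ℝ (Fin n) → ℝ}
    (hh : IsSmoothNorm h) (hn : 1 ≤ n) {u : EuclideanSpace ℝ (Fin n) → ℝ} (hu : Continuous u)
    (hu_mono : ∀ s ∈ Icc (0 : ℝ) 1, ∀ x, u (s • x) ≤ u x) :
    0 < boundarySupportIntegral u (wulff h) := by
  have hm : MeasurableSet (frontier (wulff h)) := isClosed_frontier.measurableSet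
  rw [hh.boundarySupportIntegral_eq hu]
  refine ENNReal.toReal_pos (fun h0 => ?_) ?_
  · rw [lintegral_eq_zero_iff'] at h0
    · have h1 : ∀ᵐ x ∂((μHE[n - 1]).restrict (frontier (wulff h))), False := by
        filter_upwards [ae_restrict_mem hm, h0] with x hx h2
        have h3 := mul_pos (hh.isNormalField.inner_pos hx) (Real.exp_pos (-u x))
        have h4 := ENNReal.ofReal_eq_zero.1 h2
        linarith
      rw [eventually_false_iff_eq_bot, ae_eq_bot, Measure.restrict_eq_zero] at h1
      exact (hh.isNormalField.euclideanHausdorffMeasure_frontier_pos hn).ne' h1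
    · exact ENNReal.measurable_ofReal.comp_aemeasurable
        (((hh.continuousOn_gaussMap.inner continuousOn_id).mul
          (Real.continuous_exp.comp hu.neg).continuousOn).aemeasurable hm)
  · exact ((hh.isNormalField.lintegral_frontier_le hu hu_mono).trans_lt
      (ENNReal.mul_lt_top (ENNReal.natCast_lt_top n)
        (expMeasure_lt_top hu hh.isCompact_wulff))).ne

/-! ### Concavity exponents -/

/-- Under the strong dimensional Brunn–Minkowski condition, smooth bodies have concavity exponents
arbitrarily close to `1 / n`. -/
theorem StrongDimBM.exists_exponent (hn : 1 ≤ n) {u : EuclideanSpace ℝ (Fin n) → ℝ}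
    (hu : Continuous u) (hu_mono : ∀ s ∈ Icc (0 : ℝ) 1, ∀ x, u (s • x) ≤ u x)
    (h_strong : StrongDimBM u) {h : EuclideanSpace ℝ (Fin n) → ℝ} (hh : IsSmoothNorm h) {q : ℝ}
    (hq : q < 1 / n) : ∃ p, q < p ∧ ∀ ρ : EuclideanSpace ℝ (Fin n) → ℝ,
      IsAdmissible (wulff h) ρ → SecondDerivNonposAtZero
        fun t => (expMeasure u).real (perturbation (wulff h) ρ t) ^ p := by
  have hn0 : (0 : ℝ) < n := by exact_mod_cast hn
  have h1 := h_strong (wulff h) hh.isC2Plus hh.isOriginSymmetric_wulff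
  have hB := hh.boundarySupportIntegral_pos hn hu hu_mono
  have h2 : 1 / (n : ℝ) ≤ (expMeasure u).real (wulff h) / boundarySupportIntegral u (wulff h) := by
    rw [div_le_div_iff₀ hn0 hB, one_mul, mul_comm]
    exact hh.boundarySupportIntegral_le hu hu_mono
  have h3 : 1 / (n : ℝ) ≤ concavityPower (expMeasure u) (wulff h) := h2.trans h1
  have hne : {p : ℝ | ∀ ρ : EuclideanSpace ℝ (Fin n) → ℝ, IsAdmissible (wulff h) ρ →
      SecondDerivNonposAtZero
        fun t => (expMeasure u).real (perturbation (wulff h) ρ t) ^ p}.Nonempty := by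
    -- A real supremum over the empty set is 0, which is below 1/n.
    by_contra hemp
    rw [not_nonempty_iff_eq_empty] at hemp
    rw [concavityPower, hemp, Real.sSup_empty] at h3
    have : 0 < 1 / (n : ℝ) := by positivity
    linarith
  obtain ⟨p, hp, hqp⟩ := exists_lt_of_lt_csSup hne (hq.trans_le h3)
  exact ⟨p, hqp, hp⟩

/-- Decreasing the exponent preserves `(W ^ p)'' ≤ 0`. -/
theorem SecondDerivNonposAtZero.rpow_of_le {W : ℝ → ℝ} (hW : ∀ᶠ s in 𝓝 0, 0 < W s) {p q : ℝ}
    (hq : 0 < q) (hqp : q ≤ p) (h : SecondDerivNonposAtZero fun s => W s ^ p) :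
    SecondDerivNonposAtZero fun s => W s ^ q := by
  have hp : 0 < p := hq.trans_le hqp
  obtain ⟨h1, h2, h3⟩ := h
  set G : ℝ → ℝ := fun s => W s ^ p with hG
  -- W^q = (W^p)^a with a ∈ (0, 1], a concave increasing function of W^p.
  set a := q / p with ha
  have ha0 : 0 < a := by positivity
  have ha1 : a ≤ 1 := (div_le_one hp).2 hqp
  have hGpos : ∀ᶠ s in 𝓝 0, 0 < G s := hW.mono fun s hs => Real.rpow_pos_of_pos hs p
  have heq : (fun s => W s ^ q) =ᶠ[𝓝 0] fun s => G s ^ a := by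
    filter_upwards [hW] with s hs
    rw [hG, ← Real.rpow_mul hs.le, ha, mul_div_cancel₀ _ hp.ne']
  have hd1 : ∀ᶠ s in 𝓝 0, HasDerivAt (fun s => W s ^ q) (deriv G s * a * G s ^ (a - 1)) s := by
    filter_upwards [hGpos, h1, heq.eventuallyEq_nhds] with s hs hs1 hs2
    exact (hs1.hasDerivAt.rpow_const (Or.inl hs.ne')).congr_of_eventuallyEq hs2
  have hd2 : deriv (fun s => W s ^ q) =ᶠ[𝓝 0] fun s => deriv G s * a * G s ^ (a - 1) :=
    hd1.mono fun s hs => hs.deriv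
  have hd3 : HasDerivAt (fun s => deriv G s * a * G s ^ (a - 1))
      (deriv (deriv G) 0 * a * G 0 ^ (a - 1) +
        deriv G 0 * a * (deriv G 0 * (a - 1) * G 0 ^ (a - 1 - 1))) 0 :=
    (h2.hasDerivAt.mul_const a).mul
      (h1.self_of_nhds.hasDerivAt.rpow_const (Or.inl hGpos.self_of_nhds.ne'))
  refine ⟨hd1.mono fun s hs => hs.differentiableAt, ?_, ?_⟩
  · exact (hd3.congr_of_eventuallyEq hd2).differentiableAt
  · rw [hd2.deriv_eq, hd3.deriv]
    have hG0 := hGpos.self_of_nhds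
    have e1 : deriv (deriv G) 0 * a * G 0 ^ (a - 1) ≤ 0 :=
      mul_nonpos_of_nonpos_of_nonneg (mul_nonpos_of_nonpos_of_nonneg h3 ha0.le)
        (Real.rpow_nonneg hG0.le _)
    have e2 : deriv G 0 * a * (deriv G 0 * (a - 1) * G 0 ^ (a - 1 - 1)) =
        (a - 1) * (a * (deriv G 0 ^ 2 * G 0 ^ (a - 1 - 1))) := by ring
    have e3 : (a - 1) * (a * (deriv G 0 ^ 2 * G 0 ^ (a - 1 - 1))) ≤ 0 :=
      mul_nonpos_of_nonpos_of_nonneg (by linarith)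
        (mul_nonneg ha0.le (mul_nonneg (sq_nonneg _) (Real.rpow_nonneg hG0.le _)))
    linarith

/-! ### Interpolation between two smooth bodies -/

theorem IsSmoothNorm.add {h₁ h₂ : EuclideanSpace ℝ (Fin n) → ℝ} (hh₁ : IsSmoothNorm h₁)
    (hh₂ : IsSmoothNorm h₂) {a b : ℝ} (ha : 0 < a) (hb : 0 < b) :
    IsSmoothNorm fun θ => a * h₁ θ + b * h₂ θ where
  smul c x := by rw [hh₁.smul, hh₂.smul]; ring
  pos x hx := add_pos (mul_pos ha (hh₁.pos x hx)) (mul_pos hb (hh₂.pos x hx))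
  convexOn := (hh₁.convexOn.smul ha.le).add (hh₂.convexOn.smul hb.le)
  contDiffAt x hx := (contDiffAt_const.mul (hh₁.contDiffAt x hx)).add
    (contDiffAt_const.mul (hh₂.contDiffAt x hx))
  hess_pos x hx v hv := by
    have hd : ∀ {h : EuclideanSpace ℝ (Fin n) → ℝ}, IsSmoothNorm h → ∀ y, y ≠ 0 →
        HasFDerivAt h (fderiv ℝ h y) y := fun hh y hy =>
      ((hh.contDiffAt y hy).differentiableAt (by simp)).hasFDerivAt
    have hd2 : ∀ {h : EuclideanSpace ℝ (Fin n) → ℝ}, IsSmoothNorm h →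
        HasFDerivAt (fderiv ℝ h) (fderiv ℝ (fderiv ℝ h) x) x := fun hh =>
      (((hh.contDiffAt x hx).fderiv_right (m := 1) (by norm_num)).differentiableAt
        (by simp)).hasFDerivAt
    have h1 : (fderiv ℝ fun θ => a * h₁ θ + b * h₂ θ) =ᶠ[𝓝 x]
        fun y => a • fderiv ℝ h₁ y + b • fderiv ℝ h₂ y := by
      filter_upwards [isOpen_ne.mem_nhds hx] with y hy
      exact (((hd hh₁ y hy).const_mul a).add ((hd hh₂ y hy).const_mul b)).fderiv
    have h2 : HasFDerivAt (fun y => a • fderiv ℝ h₁ y + b • fderiv ℝ h₂ y) _ x :=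
      ((hd2 hh₁).const_smul a).add ((hd2 hh₂).const_smul b)
    rw [h1.fderiv_eq, h2.fderiv]
    exact add_pos (mul_pos ha (hh₁.hess_pos x hx v hv)) (mul_pos hb (hh₂.hess_pos x hx v hv))

/-- Linear interpolation of support functions. -/
def interp (h₁ h₂ : EuclideanSpace ℝ (Fin n) → ℝ) (t : ℝ) (θ : EuclideanSpace ℝ (Fin n)) : ℝ :=
  (1 - t) * h₁ θ + t * h₂ θ

section Variation

variable {h₁ h₂ : EuclideanSpace ℝ (Fin n) → ℝ} (hh₁ : IsSmoothNorm h₁) (hh₂ : IsSmoothNorm h₂)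
include hh₁ hh₂

theorem IsSmoothNorm.interp {t : ℝ} (ht : t ∈ Ioo (0 : ℝ) 1) : IsSmoothNorm (interp h₁ h₂ t) :=
  hh₁.add hh₂ (sub_pos.2 ht.2) ht.1

/-- With ρ = (h₂ - h₁) ∘ ν, the composition ρ ∘ ν⁻¹ is h₂ - h₁ on the sphere, so perturbing the body
at time t by s is moving along the interpolation to time t + s. -/
theorem perturbedSupport_interp {t : ℝ} (ht : t ∈ Ioo (0 : ℝ) 1) (s : ℝ)
    {θ : EuclideanSpace ℝ (Fin n)} (hθ : ‖θ‖ = 1) :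
    perturbedSupport (wulff (interp h₁ h₂ t))
      (fun x => h₂ (gaussMap (wulff (interp h₁ h₂ t)) x) -
        h₁ (gaussMap (wulff (interp h₁ h₂ t)) x)) s θ = interp h₁ h₂ (t + s) θ := by
  have hh := hh₁.interp hh₂ ht
  rw [perturbedSupport, hh.gaussMap_gaussMapInv hθ,
    hh.supportFun_wulff (by rintro rfl; simp at hθ)]
  simp only [DimBM.interp]
  ring

theorem perturbation_interp {t : ℝ} (ht : t ∈ Ioo (0 : ℝ) 1) (s : ℝ) :
    perturbation (wulff (interp h₁ h₂ t))
      (fun x => h₂ (gaussMap (wulff (interp h₁ h₂ t)) x) -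
        h₁ (gaussMap (wulff (interp h₁ h₂ t)) x)) s = wulff (interp h₁ h₂ (t + s)) := by
  ext x
  refine forall₂_congr fun θ hθ => ?_
  rw [perturbedSupport_interp hh₁ hh₂ ht s hθ]

theorem isAdmissible_interp {t : ℝ} (ht : t ∈ Ioo (0 : ℝ) 1) :
    IsAdmissible (wulff (interp h₁ h₂ t))
      (fun x => h₂ (gaussMap (wulff (interp h₁ h₂ t)) x) -
        h₁ (gaussMap (wulff (interp h₁ h₂ t)) x)) := by
  refine ⟨min t (1 - t), lt_min ht.1 (sub_pos.2 ht.2), fun s hs => ?_⟩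
  have h1 := abs_lt.1 (hs.trans_le (min_le_left _ _))
  have h2 := abs_lt.1 (hs.trans_le (min_le_right _ _))
  have hh := hh₁.interp hh₂ (t := t + s) ⟨by linarith, by linarith⟩
  refine ⟨wulff (interp h₁ h₂ (t + s)), hh.isC2Plus, fun θ hθ => ?_⟩
  rw [perturbedSupport_interp hh₁ hh₂ ht s hθ, hh.supportFun_wulff (by rintro rfl; simp at hθ)]

variable (hn : 1 ≤ n) {u : EuclideanSpace ℝ (Fin n) → ℝ} (hu : Continuous u)
  (hu_mono : ∀ s ∈ Icc (0 : ℝ) 1, ∀ x, u (s • x) ≤ u x) (h_strong : StrongDimBM u)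
include hn hu hu_mono h_strong

/-- Local-to-global: along the interpolation the powers of the measure below `1 / n` are concave. -/
theorem concaveOn_measure_interp_rpow {q : ℝ} (hq : q ∈ Ioo (0 : ℝ) (1 / n)) :
    ConcaveOn ℝ (Ioo (0 : ℝ) 1) fun t => (expMeasure u).real (wulff (interp h₁ h₂ t)) ^ q := by
  set W : ℝ → ℝ := fun t => (expMeasure u).real (wulff (interp h₁ h₂ t)) with hW
  have hWpos : ∀ t ∈ Ioo (0 : ℝ) 1, 0 < W t := fun t ht =>
    ENNReal.toReal_pos (expMeasure_pos hu (hh₁.interp hh₂ ht).wulff_mem_nhds).ne'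
      (expMeasure_lt_top hu (hh₁.interp hh₂ ht).isCompact_wulff).ne
  have hshift : ∀ t ∈ Ioo (0 : ℝ) 1, SecondDerivNonposAtZero fun s => W (t + s) ^ q := by
    intro t ht
    -- The exponent p depends on t; lowering it to the fixed q makes the local inequalities refer to
    -- one function.
    obtain ⟨p, hqp, hp⟩ := h_strong.exists_exponent hn hu hu_mono (hh₁.interp hh₂ ht) hq.2
    have h1 := hp _ (isAdmissible_interp hh₁ hh₂ ht)
    simp only [perturbation_interp hh₁ hh₂ ht] at h1
    refine SecondDerivNonposAtZero.rpow_of_le (W := fun s => W (t + s)) ?_ hq.1 hqp.le h1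
    have hc : Tendsto (fun s => t + s) (𝓝 0) (𝓝 t) := by
      have : Continuous fun s : ℝ => t + s := by fun_prop
      simpa using this.tendsto 0
    filter_upwards [hc.eventually (isOpen_Ioo.mem_nhds ht)] with s hs using hWpos _ hs
  set f : ℝ → ℝ := fun t => W t ^ q with hf
  have hderiv : ∀ t ∈ Ioo (0 : ℝ) 1, DifferentiableAt ℝ f t ∧ DifferentiableAt ℝ (deriv f) t ∧
      deriv (deriv f) t ≤ 0 := by
    intro t ht
    obtain ⟨h1, h2, h3⟩ := hshift t ht
    have hback : ∀ {g : ℝ → ℝ}, DifferentiableAt ℝ (fun s => g (t + s)) 0 →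
        DifferentiableAt ℝ g t := fun {g} hg => by
      have h : DifferentiableAt ℝ (fun x => x - t) t := by fun_prop
      have := DifferentiableAt.comp t (g := fun s => g (t + s)) (f := fun x => x - t)
        (by simpa using hg) h
      simpa [Function.comp_def] using this
    have e1 : deriv (fun s => f (t + s)) = fun s => deriv f (t + s) := by
      ext s; exact deriv_comp_const_add _ _ _
    change DifferentiableAt ℝ (deriv fun s => f (t + s)) 0 at h2
    change deriv (deriv fun s => f (t + s)) 0 ≤ 0 at h3
    have h1 : DifferentiableAt ℝ (fun s => f (t + s)) 0 := h1.self_of_nhds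
    rw [e1] at h2 h3
    rw [deriv_comp_const_add, add_zero] at h3
    exact ⟨hback h1, hback h2, h3⟩
  refine concaveOn_of_deriv2_nonpos (convex_Ioo 0 1)
    (fun t ht => (hderiv t ht).1.continuousAt.continuousWithinAt) ?_ ?_ ?_
  · rw [interior_Ioo]; exact fun t ht => (hderiv t ht).1.differentiableWithinAt
  · rw [interior_Ioo]; exact fun t ht => (hderiv t ht).2.1.differentiableWithinAt
  · rw [interior_Ioo]; exact fun t ht => (hderiv t ht).2.2

theorem le_measure_interp_rpow {t : ℝ} (ht : t ∈ Ioo (0 : ℝ) 1) :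
    (1 - t) * (expMeasure u).real (wulff h₁) ^ (1 / (n : ℝ)) +
      t * (expMeasure u).real (wulff h₂) ^ (1 / (n : ℝ)) ≤
      (expMeasure u).real (wulff (interp h₁ h₂ t)) ^ (1 / (n : ℝ)) := by
  set W : ℝ → ℝ := fun t => (expMeasure u).real (wulff (interp h₁ h₂ t)) with hW
  set m₁ := (expMeasure u).real (wulff h₁) with hm₁
  set m₂ := (expMeasure u).real (wulff h₂) with hm₂
  have hpos : ∀ {h : EuclideanSpace ℝ (Fin n) → ℝ}, IsSmoothNorm h →
      0 < (expMeasure u).real (wulff h) := fun hh =>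
    ENNReal.toReal_pos (expMeasure_pos hu hh.wulff_mem_nhds).ne'
      (expMeasure_lt_top hu hh.isCompact_wulff).ne
  have hn0 : (0 : ℝ) < n := by exact_mod_cast hn
  -- comparison near the end points
  have hscale : ∀ {h k : EuclideanSpace ℝ (Fin n) → ℝ} {c : ℝ}, IsSmoothNorm h → IsSmoothNorm k →
      c ∈ Ioc (0 : ℝ) 1 → (∀ θ, c * h θ ≤ k θ) →
      c ^ n * (expMeasure u).real (wulff h) ≤ (expMeasure u).real (wulff k) := by
    intro h k c hh hk hc hle
    have h1 := ofReal_pow_mul_expMeasure_le hu_mono hc (wulff h)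
    have h2 : c • wulff h ⊆ wulff k := by
      rintro _ ⟨x, hx, rfl⟩ θ hθ
      simp only
      rw [inner_smul_right]
      exact (mul_le_mul_of_nonneg_left (hx θ hθ) hc.1.le).trans (hle θ)
    have h3 := ENNReal.toReal_mono (expMeasure_lt_top hu hk.isCompact_wulff).ne
      (h1.trans (measure_mono h2))
    rwa [ENNReal.toReal_mul, ENNReal.toReal_ofReal (pow_nonneg hc.1.le n)] at h3
  -- Concavity is known only on the open interval. These lower bounds near its ends hold because the
  -- interpolated body contains (1 - s) times the nearer end body.
  have hend : ∀ s ∈ Ioo (0 : ℝ) 1, (1 - s) ^ n * m₁ ≤ W s ∧ (1 - s) ^ n * m₂ ≤ W (1 - s) := by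
    intro s hs
    have hs' : 1 - s ∈ Ioo (0 : ℝ) 1 := ⟨by linarith [hs.2], by linarith [hs.1]⟩
    refine ⟨hscale hh₁ (hh₁.interp hh₂ hs) ⟨hs'.1, hs'.2.le⟩ fun θ => ?_,
      hscale hh₂ (hh₁.interp hh₂ hs') ⟨hs'.1, hs'.2.le⟩ fun θ => ?_⟩
    · exact le_add_of_nonneg_right (mul_nonneg hs.1.le (hh₂.nonneg θ))
    · exact le_add_of_nonneg_left (mul_nonneg (by linarith [hs.1]) (hh₁.nonneg θ))
  have hq : ∀ q ∈ Ioo (0 : ℝ) (1 / n), (1 - t) * m₁ ^ q + t * m₂ ^ q ≤ W t ^ q := by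
    intro q hq
    have hconc := concaveOn_measure_interp_rpow hh₁ hh₂ hn hu hu_mono h_strong hq
    -- (t - s)/(1 - 2s) is the weight that expresses t as a convex combination of s and 1 - s; then
    -- s → 0.
    have hlim : Tendsto (fun s : ℝ => (1 - (t - s) / (1 - 2 * s)) * ((1 - s) ^ n * m₁) ^ q +
        (t - s) / (1 - 2 * s) * ((1 - s) ^ n * m₂) ^ q) (𝓝[>] 0)
        (𝓝 ((1 - t) * m₁ ^ q + t * m₂ ^ q)) := by
      have hc : ContinuousAt (fun s : ℝ => (1 - (t - s) / (1 - 2 * s)) * ((1 - s) ^ n * m₁) ^ q +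
        (t - s) / (1 - 2 * s) * ((1 - s) ^ n * m₂) ^ q) 0 := by
        have c1 : ContinuousAt (fun s : ℝ => (t - s) / (1 - 2 * s)) 0 :=
          ContinuousAt.div (by fun_prop) (by fun_prop) (by norm_num)
        have c2 : ∀ m : ℝ, ContinuousAt (fun s : ℝ => ((1 - s) ^ n * m) ^ q) 0 := fun m =>
          ContinuousAt.rpow_const (by fun_prop) (Or.inr hq.1.le)
        exact ((continuousAt_const.sub c1).mul (c2 m₁)).add (c1.mul (c2 m₂))
      have := hc.tendsto
      simp only [sub_zero, mul_zero, div_one, one_pow, one_mul] at this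
      exact this.mono_left nhdsWithin_le_nhds
    refine le_of_tendsto hlim ?_
    have hsmall : ∀ᶠ s in 𝓝[>] (0 : ℝ), s < min t (1 - t) :=
      nhdsWithin_le_nhds (gt_mem_nhds (lt_min ht.1 (sub_pos.2 ht.2)))
    filter_upwards [hsmall, self_mem_nhdsWithin] with s hs hs0
    have hs0 : 0 < s := hs0
    have h1 := hs.trans_le (min_le_left _ _)
    have h2 := hs.trans_le (min_le_right _ _)
    have hden : 0 < 1 - 2 * s := by linarith
    have hs1 : s ∈ Ioo (0 : ℝ) 1 := ⟨hs0, by linarith⟩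
    have hs2 : 1 - s ∈ Ioo (0 : ℝ) 1 := ⟨by linarith, by linarith⟩
    have hl0 : 0 ≤ (t - s) / (1 - 2 * s) := div_nonneg (by linarith) hden.le
    have hl1 : 0 ≤ 1 - (t - s) / (1 - 2 * s) := by
      rw [sub_nonneg, div_le_one hden]; linarith
    have h3 := hconc.2 hs1 hs2 hl1 hl0 (by ring)
    have h4 : (1 - (t - s) / (1 - 2 * s)) • s + ((t - s) / (1 - 2 * s)) • (1 - s) = t := by
      have := div_mul_cancel₀ (t - s) hden.ne'
      simp only [smul_eq_mul]
      linear_combination this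
    rw [h4] at h3
    refine le_trans ?_ h3
    simp only [smul_eq_mul]
    have hp0 : (0 : ℝ) ≤ (1 - s) ^ n := pow_nonneg hs2.1.le n
    exact add_le_add
      (mul_le_mul_of_nonneg_left (Real.rpow_le_rpow (mul_nonneg hp0 (hpos hh₁).le)
        (hend s hs1).1 hq.1.le) hl1)
      (mul_le_mul_of_nonneg_left (Real.rpow_le_rpow (mul_nonneg hp0 (hpos hh₂).le)
        (hend s hs1).2 hq.1.le) hl0)
  have hcq : ∀ {m : ℝ}, 0 < m → Tendsto (fun q : ℝ => m ^ q) (𝓝[<] (1 / (n : ℝ)))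
      (𝓝 (m ^ (1 / (n : ℝ)))) := fun hm =>
    (Real.continuousAt_const_rpow hm.ne').tendsto.mono_left nhdsWithin_le_nhds
  refine le_of_tendsto_of_tendsto (((hcq (hpos hh₁)).const_mul (1 - t)).add
    ((hcq (hpos hh₂)).const_mul t)) (hcq (hpos (hh₁.interp hh₂ ht))) ?_
  have hpos' : (0 : ℝ) < 1 / n := by positivity
  filter_upwards [self_mem_nhdsWithin, nhdsWithin_le_nhds (lt_mem_nhds hpos')] with q hq1 hq2
  exact hq q ⟨hq2, hq1⟩

end Variation

/-- A functional θ strictly separating a point from the Minkowski combination would exceed its value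
at (1-t)∇h₁(θ) + t∇h₂(θ), which is already the interpolated support function at θ. -/
theorem wulff_interp_subset {h₁ h₂ : EuclideanSpace ℝ (Fin n) → ℝ} (hh₁ : IsSmoothNorm h₁)
    (hh₂ : IsSmoothNorm h₂) {t : ℝ} (ht : t ∈ Ioo (0 : ℝ) 1) :
    wulff (interp h₁ h₂ t) ⊆ (1 - t) • wulff h₁ + t • wulff h₂ := by
  have hconv : Convex ℝ ((1 - t) • wulff h₁ + t • wulff h₂) :=
    ((convex_wulff h₁).smul _).add ((convex_wulff h₂).smul _)
  have hcomp : IsCompact ((1 - t) • wulff h₁ + t • wulff h₂) :=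
    (hh₁.isCompact_wulff.smul _).add (hh₂.isCompact_wulff.smul _)
  intro x hx
  by_contra hxS
  obtain ⟨f, s, hf, hs⟩ := geometric_hahn_banach_closed_point hconv hcomp.isClosed hxS
  set θ := (InnerProductSpace.toDual ℝ (EuclideanSpace ℝ (Fin n))).symm f with hθ
  have hfθ : ∀ y, f y = inner ℝ θ y := fun y => InnerProductSpace.toDual_symm_apply.symm
  have hθ0 : θ ≠ 0 := by
    intro h0
    have h1 := hf ((1 - t) • 0 + t • 0) (add_mem_add
      (smul_mem_smul_set (mem_of_mem_nhds hh₁.wulff_mem_nhds))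
      (smul_mem_smul_set (mem_of_mem_nhds hh₂.wulff_mem_nhds)))
    rw [hfθ, h0] at h1
    rw [hfθ, h0] at hs
    simp at h1 hs
    linarith
  have h1 := hf ((1 - t) • gradient h₁ θ + t • gradient h₂ θ) (add_mem_add
    (smul_mem_smul_set (hh₁.gradient_mem_wulff hθ0))
    (smul_mem_smul_set (hh₂.gradient_mem_wulff hθ0)))
  rw [hfθ, inner_add_right, inner_smul_right, inner_smul_right, hh₁.inner_gradient_self hθ0,
    hh₂.inner_gradient_self hθ0] at h1
  have h2 := (hh₁.interp hh₂ ht).mem_wulff.1 hx θ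
  rw [hfθ] at hs
  simp only [interp] at h2
  linarith

/-! ### Inner approximation by smooth bodies -/

/-- Strict convexity of the Euclidean norm in non-radial directions. -/
theorem fderiv_fderiv_norm_pos {x v : EuclideanSpace ℝ (Fin n)} (hx : x ≠ 0)
    (hv : ∀ c : ℝ, v ≠ c • x) :
    0 < fderiv ℝ (fderiv ℝ fun y : EuclideanSpace ℝ (Fin n) => ‖y‖) x v v := by
  have hxn : 0 < ‖x‖ := norm_pos_iff.2 hx
  have hc : ContDiffAt ℝ 2 (fun y : EuclideanSpace ℝ (Fin n) => ‖y‖) x := contDiffAt_norm ℝ hx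
  have h1 := fderiv_fderiv_sq_half hc v v
  have hsq : ∀ y : EuclideanSpace ℝ (Fin n),
      HasFDerivAt (fun y : EuclideanSpace ℝ (Fin n) => ‖y‖ ^ 2 / 2) (innerSL ℝ y) y := fun y => by
    simp only [div_eq_mul_inv]
    refine ((hasStrictFDerivAt_norm_sq y).hasFDerivAt.mul_const (2⁻¹ : ℝ)).congr_fderiv ?_
    ext w
    simp
  have h2 : (fderiv ℝ fun y : EuclideanSpace ℝ (Fin n) => ‖y‖ ^ 2 / 2) = fun y => innerSL ℝ y :=
    funext fun y => (hsq y).fderiv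
  rw [h2, (innerSL ℝ).hasFDerivAt.fderiv] at h1
  have h3 : ‖x‖ * fderiv ℝ (fun y : EuclideanSpace ℝ (Fin n) => ‖y‖) x v = inner ℝ x v := by
    have hd := (hc.differentiableAt (by simp)).hasFDerivAt
    have h4 : HasFDerivAt (fun y : EuclideanSpace ℝ (Fin n) => ‖y‖ ^ 2 / 2)
        (‖x‖ • fderiv ℝ (fun y : EuclideanSpace ℝ (Fin n) => ‖y‖) x) x := by
      simp only [div_eq_mul_inv]
      refine ((hd.pow 2).mul_const (2⁻¹ : ℝ)).congr_fderiv ?_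
      ext w
      simp
      ring
    have h5 := congrArg (fun L => L v) (h4.unique (hsq x))
    simpa using h5
  set a := fderiv ℝ (fun y : EuclideanSpace ℝ (Fin n) => ‖y‖) x v with ha
  have h6 : inner ℝ v v = ‖x‖ * fderiv ℝ (fderiv ℝ fun y : EuclideanSpace ℝ (Fin n) => ‖y‖) x v v
      + a * a := h1
  have hw : 0 < inner ℝ (v - (a / ‖x‖) • x) (v - (a / ‖x‖) • x) := by
    rw [real_inner_self_pos]
    exact sub_ne_zero.2 (hv _)
  have h7 : inner ℝ (v - (a / ‖x‖) • x) (v - (a / ‖x‖) • x) = inner ℝ v v - a * a := by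
    rw [inner_sub_left, inner_sub_right, inner_sub_right, inner_smul_left, inner_smul_right,
      inner_smul_left, inner_smul_right, real_inner_self_eq_norm_sq x, real_inner_comm x v, ← h3]
    simp only [conj_trivial]
    field_simp
    ring
  rw [h7, h6] at hw
  exact (mul_pos_iff_of_pos_left hxn).1 (by linarith)

/-- A convex seminorm has only a non-negative Hessian; the Euclidean term supplies positivity in
non-radial directions and away from zero. -/
theorem isSmoothNorm_add_norm {N : EuclideanSpace ℝ (Fin n) → ℝ}
    (hsmul : ∀ (c : ℝ) x, N (c • x) = |c| * N x) (hnonneg : ∀ x, 0 ≤ N x)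
    (hconv : ConvexOn ℝ univ N) (hdiff : ∀ x, x ≠ 0 → ContDiffAt ℝ 2 N x) {ε : ℝ} (hε : 0 < ε) :
    IsSmoothNorm fun x => N x + ε * ‖x‖ where
  smul c x := by rw [hsmul, norm_smul, Real.norm_eq_abs]; ring
  pos x hx := add_pos_of_nonneg_of_pos (hnonneg x) (mul_pos hε (norm_pos_iff.2 hx))
  convexOn := hconv.add (convexOn_univ_norm.smul hε.le)
  contDiffAt x hx := (hdiff x hx).add (contDiffAt_const.mul (contDiffAt_norm ℝ hx))
  hess_pos x hx v hv := by
    have hd : ∀ y, y ≠ 0 → HasFDerivAt N (fderiv ℝ N y) y := fun y hy =>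
      ((hdiff y hy).differentiableAt (by simp)).hasFDerivAt
    have hd' : ∀ y : EuclideanSpace ℝ (Fin n), y ≠ 0 →
        HasFDerivAt (fun z => ‖z‖) (fderiv ℝ (fun z : EuclideanSpace ℝ (Fin n) => ‖z‖) y) y :=
      fun y hy => ((contDiffAt_norm (n := 2) ℝ hy).differentiableAt (by simp)).hasFDerivAt
    have hd2 : HasFDerivAt (fderiv ℝ N) (fderiv ℝ (fderiv ℝ N) x) x :=
      (((hdiff x hx).fderiv_right (m := 1) (by norm_num)).differentiableAt (by simp)).hasFDerivAt
    have hd2' := (((contDiffAt_norm (n := 2) ℝ hx).fderiv_right (m := 1)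
      (by norm_num)).differentiableAt (by simp)).hasFDerivAt
    have h1 : (fderiv ℝ fun y => N y + ε * ‖y‖) =ᶠ[𝓝 x]
        fun y => fderiv ℝ N y + ε • fderiv ℝ (fun z : EuclideanSpace ℝ (Fin n) => ‖z‖) y := by
      filter_upwards [isOpen_ne.mem_nhds hx] with y hy
      exact ((hd y hy).add ((hd' y hy).const_mul ε)).fderiv
    have h2 : HasFDerivAt (fun y => fderiv ℝ N y +
        ε • fderiv ℝ (fun z : EuclideanSpace ℝ (Fin n) => ‖z‖) y) _ x :=
      hd2.add (hd2'.const_smul ε)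
    rw [h1.fderiv_eq, h2.fderiv]
    exact add_pos_of_nonneg_of_pos (fderiv_fderiv_nonneg_of_convexOn hconv (hdiff x hx) v)
      (mul_pos hε (fderiv_fderiv_norm_pos hx hv))

/-- The `ℓᵖ` norm of the values `⟨v, x⟩` for `v ∈ F`, for the exponent `p = 2 (k + 1)`. -/
def lpSupport (F : Finset (EuclideanSpace ℝ (Fin n))) (k : ℕ) (x : EuclideanSpace ℝ (Fin n)) : ℝ :=
  (∑ v ∈ F, inner ℝ v x ^ (2 * (k + 1))) ^ (1 / ((2 * (k + 1) : ℕ) : ℝ))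

section LpSupport

variable (F : Finset (EuclideanSpace ℝ (Fin n))) (k : ℕ)

theorem lpSupport_sum_nonneg (x : EuclideanSpace ℝ (Fin n)) :
    0 ≤ ∑ v ∈ F, inner ℝ v x ^ (2 * (k + 1)) :=
  Finset.sum_nonneg fun _ _ => (even_two_mul (k + 1)).pow_nonneg _

theorem lpSupport_nonneg (x : EuclideanSpace ℝ (Fin n)) : 0 ≤ lpSupport F k x :=
  Real.rpow_nonneg (lpSupport_sum_nonneg F k x) _

theorem lpSupport_smul (c : ℝ) (x : EuclideanSpace ℝ (Fin n)) :
    lpSupport F k (c • x) = |c| * lpSupport F k x := by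
  simp only [lpSupport, inner_smul_right, mul_pow]
  rw [← Finset.mul_sum, Real.mul_rpow ((even_two_mul (k + 1)).pow_nonneg _)
    (lpSupport_sum_nonneg F k x), ← (even_two_mul (k + 1)).pow_abs, one_div,
    Real.pow_rpow_inv_natCast (abs_nonneg c) (by omega)]

theorem abs_inner_le_lpSupport {v : EuclideanSpace ℝ (Fin n)} (hv : v ∈ F)
    (x : EuclideanSpace ℝ (Fin n)) : |inner ℝ v x| ≤ lpSupport F k x := by
  have h1 : |inner ℝ v x| ^ (2 * (k + 1)) ≤ ∑ v ∈ F, inner ℝ v x ^ (2 * (k + 1)) := by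
    rw [(even_two_mul (k + 1)).pow_abs]
    exact Finset.single_le_sum (f := fun v => inner ℝ v x ^ (2 * (k + 1)))
      (fun v _ => (even_two_mul (k + 1)).pow_nonneg _) hv
  calc |inner ℝ v x| = (|inner ℝ v x| ^ (2 * (k + 1))) ^ (1 / ((2 * (k + 1) : ℕ) : ℝ)) := by
        rw [one_div, Real.pow_rpow_inv_natCast (abs_nonneg _) (by omega)]
    _ ≤ _ := Real.rpow_le_rpow (by positivity) h1 (by positivity)

theorem lpSupport_le {x : EuclideanSpace ℝ (Fin n)} {M : ℝ} (hM0 : 0 ≤ M)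
    (hM : ∀ v ∈ F, |inner ℝ v x| ≤ M) :
    lpSupport F k x ≤ (F.card : ℝ) ^ (1 / ((2 * (k + 1) : ℕ) : ℝ)) * M := by
  have h1 : ∑ v ∈ F, inner ℝ v x ^ (2 * (k + 1)) ≤ F.card * M ^ (2 * (k + 1)) := by
    rw [← nsmul_eq_mul]
    refine Finset.sum_le_card_nsmul _ _ _ fun v hv => ?_
    rw [← (even_two_mul (k + 1)).pow_abs]
    exact pow_le_pow_left₀ (abs_nonneg _) (hM v hv) _
  calc lpSupport F k x ≤ (F.card * M ^ (2 * (k + 1))) ^ (1 / ((2 * (k + 1) : ℕ) : ℝ)) :=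
        Real.rpow_le_rpow (lpSupport_sum_nonneg F k x) h1 (by positivity)
    _ = _ := by
        rw [Real.mul_rpow (by positivity) (by positivity), one_div,
          Real.pow_rpow_inv_natCast hM0 (by omega)]

/-- It is the norm of `PiLp` composed with the linear map x ↦ (⟨v, x⟩)_v. -/
theorem convexOn_lpSupport : ConvexOn ℝ univ (lpSupport F k) := by
  have : Fact ((1 : ENNReal) ≤ ((2 * (k + 1) : ℕ) : ENNReal)) :=
    ⟨by exact_mod_cast (by omega : 1 ≤ 2 * (k + 1))⟩
  let A : EuclideanSpace ℝ (Fin n) →ₗ[ℝ] PiLp ((2 * (k + 1) : ℕ) : ENNReal) fun _ : F => ℝ :=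
    (WithLp.linearEquiv _ ℝ (F → ℝ)).symm.toLinearMap ∘ₗ
      LinearMap.pi fun v : F => (innerₛₗ ℝ (v : EuclideanSpace ℝ (Fin n)))
  have hA : lpSupport F k = fun x => ‖A x‖ := by
    ext x
    rw [PiLp.norm_eq_sum (by rw [ENNReal.toReal_natCast]; positivity)]
    simp only [ENNReal.toReal_natCast, Real.rpow_natCast, lpSupport]
    congr 1
    rw [← Finset.sum_coe_sort]
    refine Finset.sum_congr rfl fun v _ => ?_
    rw [Real.norm_eq_abs, (even_two_mul (k + 1)).pow_abs]
    rfl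
  rw [hA]
  exact convexOn_univ_norm.comp_linearMap A

theorem contDiffAt_lpSupport {x : EuclideanSpace ℝ (Fin n)} (hx : ∃ v ∈ F, inner ℝ v x ≠ 0) :
    ContDiffAt ℝ 2 (lpSupport F k) x := by
  obtain ⟨v, hv, hvx⟩ := hx
  have hpos : 0 < ∑ v ∈ F, inner ℝ v x ^ (2 * (k + 1)) :=
    Finset.sum_pos' (fun v _ => (even_two_mul (k + 1)).pow_nonneg _)
      ⟨v, hv, (even_two_mul (k + 1)).pow_pos hvx⟩
  refine ContDiffAt.rpow_const_of_ne ?_ hpos.ne'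
  exact ContDiffAt.sum fun v _ => (contDiffAt_const.inner ℝ contDiffAt_id).pow _

end LpSupport

/-- The support function of the hull of F ∪ -F is max |⟨v, ·⟩|. The ℓᵖ norm lies above it and
exceeds it by less than (δ/2)‖·‖ for large p; adding (δ/2)‖·‖ gives a smooth norm below the support
function of the δ-thickened hull, which fits into K. -/
theorem exists_isSmoothNorm_of_finset {F : Finset (EuclideanSpace ℝ (Fin n))} (hne : F.Nonempty)
    (hspan : ∀ x, x ≠ 0 → ∃ v ∈ F, inner ℝ v x ≠ 0) {K : Set (EuclideanSpace ℝ (Fin n))}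
    (hK : Convex ℝ K) (hsymm : IsOriginSymmetric K) (hF : ↑F ⊆ interior K) :
    ∃ h, IsSmoothNorm h ∧ ↑F ⊆ wulff h ∧ wulff h ⊆ K := by
  have hKneg : -K = K := by
    ext x
    exact ⟨fun hx => by simpa using hsymm _ hx, fun hx => hsymm x hx⟩
  have hint : ∀ x ∈ interior K, -x ∈ interior K := fun x hx => by
    have h1 := (Homeomorph.neg (EuclideanSpace ℝ (Fin n))).preimage_interior K
    have h2 : ⇑(Homeomorph.neg (EuclideanSpace ℝ (Fin n))) ⁻¹' K = K := hKneg
    rw [h2] at h1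
    rw [← h1] at hx
    exact hx
  set P := convexHull ℝ ((F : Set (EuclideanSpace ℝ (Fin n))) ∪ -F) with hP
  have hPcomp : IsCompact P :=
    (F.finite_toSet.union F.finite_toSet.neg).isCompact_convexHull ℝ
  have hPK : P ⊆ interior K := by
    refine convexHull_min (union_subset hF fun x hx => ?_) hK.interior
    have := hint _ (hF hx)
    simpa using this
  obtain ⟨δ, hδ, hthick⟩ := hPcomp.exists_cthickening_subset_open isOpen_interior hPK
  rw [← hPcomp.add_closedBall_zero hδ.le] at hthick
  obtain ⟨R, hR⟩ := F.finite_toSet.isCompact.isBounded.exists_norm_le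
  have hR0 : 0 ≤ R := by
    obtain ⟨v, hv⟩ := hne
    exact (norm_nonneg v).trans (hR v hv)
  have hcard : (1 : ℝ) ≤ F.card := by exact_mod_cast hne.card_pos
  obtain ⟨k, hk⟩ : ∃ k : ℕ,
      ((F.card : ℝ) ^ (1 / ((2 * (k + 1) : ℕ) : ℝ)) - 1) * R < δ / 2 := by
    have h1 : Tendsto (fun k : ℕ => 1 / ((2 * (k + 1) : ℕ) : ℝ)) atTop (𝓝 0) :=
      tendsto_one_div_atTop_nhds_zero_nat.comp
        (tendsto_atTop_mono (fun k => show k ≤ 2 * (k + 1) by omega) tendsto_id)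
    have h2 : Tendsto (fun k : ℕ => ((F.card : ℝ) ^ (1 / ((2 * (k + 1) : ℕ) : ℝ)) - 1) * R) atTop
        (𝓝 (((F.card : ℝ) ^ (0 : ℝ) - 1) * R)) :=
      (((Real.continuousAt_const_rpow (by positivity)).tendsto.comp h1).sub_const 1).mul_const R
    rw [Real.rpow_zero, sub_self, zero_mul] at h2
    exact (h2.eventually (gt_mem_nhds (half_pos hδ))).exists
  set h : EuclideanSpace ℝ (Fin n) → ℝ := fun x => lpSupport F k x + δ / 2 * ‖x‖ with hh
  have hsm : IsSmoothNorm h := isSmoothNorm_add_norm (lpSupport_smul F k) (lpSupport_nonneg F k)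
    (convexOn_lpSupport F k) (fun x hx => contDiffAt_lpSupport F k (hspan x hx)) (half_pos hδ)
  refine ⟨h, hsm, fun v hv θ hθ => ?_, fun x hx => ?_⟩
  · rw [real_inner_comm]
    have h1 := (le_abs_self _).trans (abs_inner_le_lpSupport F k hv θ)
    have : 0 ≤ δ / 2 * ‖θ‖ := by positivity
    simp only [hh]
    linarith
  by_contra hxK
  have hxS : x ∉ P + Metric.closedBall 0 δ := fun hx' => hxK (interior_subset (hthick hx'))
  obtain ⟨f, s, hf, hs⟩ := geometric_hahn_banach_closed_point
    ((convex_convexHull ℝ _).add (convex_closedBall 0 δ))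
    (hPcomp.add (isCompact_closedBall 0 δ)).isClosed hxS
  set θ := (InnerProductSpace.toDual ℝ (EuclideanSpace ℝ (Fin n))).symm f with hθ
  have hfθ : ∀ y, f y = inner ℝ θ y := fun y => InnerProductSpace.toDual_symm_apply.symm
  -- The point of the ball where θ is largest; for θ = 0 division by zero makes it the origin, and
  -- the bounds persist.
  have hball : (δ / ‖θ‖) • θ ∈ Metric.closedBall (0 : EuclideanSpace ℝ (Fin n)) δ := by
    rw [mem_closedBall_zero_iff, norm_smul, norm_div, norm_norm, Real.norm_eq_abs, abs_of_pos hδ]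
    rcases eq_or_ne ‖θ‖ 0 with h0 | h0
    · simp [h0, hδ.le]
    · rw [div_mul_cancel₀ _ h0]
  have hinner : inner ℝ θ ((δ / ‖θ‖) • θ) = δ * ‖θ‖ := by
    rw [inner_smul_right, real_inner_self_eq_norm_sq]
    rcases eq_or_ne ‖θ‖ 0 with h0 | h0
    · simp [h0]
    · field_simp
  have hle : ∀ v ∈ F, |inner ℝ v θ| + δ * ‖θ‖ ≤ s := by
    intro v hv
    have h1 := hf _ (add_mem_add (subset_convexHull ℝ _ (Or.inl hv : v ∈ _)) hball)
    have h2 := hf _ (add_mem_add (subset_convexHull ℝ _ (Or.inr (by simpa using hv) : -v ∈ _)) hball)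
    rw [hfθ, inner_add_right, hinner, real_inner_comm] at h1
    rw [hfθ, inner_add_right, hinner, inner_neg_right, real_inner_comm] at h2
    rcases abs_cases (inner ℝ v θ) with ⟨h3, -⟩ | ⟨h3, -⟩ <;> rw [h3] <;> linarith
  obtain ⟨v₀, hv₀, hmax⟩ := F.exists_max_image (fun v => |inner ℝ v θ|) hne
  have h1 := lpSupport_le F k (abs_nonneg _) hmax
  have h2 := hle v₀ hv₀
  have h3 : |inner ℝ v₀ θ| ≤ R * ‖θ‖ :=
    (abs_real_inner_le_norm _ _).trans (by gcongr; exact hR v₀ hv₀)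
  have h4 := hsm.mem_wulff.1 hx θ
  rw [hfθ] at hs
  simp only [hh] at h4
  have hone : 1 ≤ (F.card : ℝ) ^ (1 / ((2 * (k + 1) : ℕ) : ℝ)) :=
    Real.one_le_rpow hcard (by positivity)
  have h5 : ((F.card : ℝ) ^ (1 / ((2 * (k + 1) : ℕ) : ℝ)) - 1) * |inner ℝ v₀ θ| ≤ δ / 2 * ‖θ‖ := by
    calc _ ≤ ((F.card : ℝ) ^ (1 / ((2 * (k + 1) : ℕ) : ℝ)) - 1) * (R * ‖θ‖) := by
          gcongr
      _ = ((F.card : ℝ) ^ (1 / ((2 * (k + 1) : ℕ) : ℝ)) - 1) * R * ‖θ‖ := by ring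
      _ ≤ _ := by gcongr
  linarith

/-- Inner approximation of symmetric convex sets by smooth symmetric bodies. -/
theorem exists_isSmoothNorm_between {K Q : Set (EuclideanSpace ℝ (Fin n))} (hK : Convex ℝ K)
    (hsymm : IsOriginSymmetric K) (h0 : (0 : EuclideanSpace ℝ (Fin n)) ∈ interior K)
    (hQ : IsCompact Q) (hQK : Q ⊆ interior K) :
    ∃ h, IsSmoothNorm h ∧ Q ⊆ wulff h ∧ wulff h ⊆ K := by
  obtain ⟨r, hr, hrK⟩ := Metric.nhds_basis_closedBall.mem_iff.1 (isOpen_interior.mem_nhds h0)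
  -- Including a ball around 0 forces the finite set F to span, as differentiability of the ℓᵖ norm
  -- off the origin requires.
  have hcomp : IsCompact (Q ∪ Metric.closedBall 0 r) := hQ.union (isCompact_closedBall 0 r)
  obtain ⟨F, hFK, hF⟩ : ∃ F : Finset (EuclideanSpace ℝ (Fin n)), ↑F ⊆ interior K ∧
      Q ∪ Metric.closedBall 0 r ⊆ convexHull ℝ (F : Set (EuclideanSpace ℝ (Fin n))) := by
    classical
    refine hcomp.induction_on (p := fun S => ∃ F : Finset (EuclideanSpace ℝ (Fin n)),
      ↑F ⊆ interior K ∧ S ⊆ convexHull ℝ (F : Set (EuclideanSpace ℝ (Fin n)))) ?_ ?_ ?_ ?_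
    · exact ⟨∅, by simp, by simp⟩
    · rintro s t hst ⟨F, h1, h2⟩
      exact ⟨F, h1, hst.trans h2⟩
    · rintro s t ⟨F, h1, h2⟩ ⟨G, h3, h4⟩
      refine ⟨F ∪ G, by simpa using ⟨h1, h3⟩, union_subset (h2.trans (convexHull_mono ?_))
        (h4.trans (convexHull_mono ?_))⟩ <;> simp
    · intro x hx
      have hxK : x ∈ interior K := union_subset hQK hrK hx
      obtain ⟨b, hb, hbK⟩ := exists_mem_interior_convexHull_affineBasis
        (isOpen_interior.mem_nhds hxK)
      refine ⟨convexHull ℝ (range b), mem_nhdsWithin_of_mem_nhds (mem_interior_iff_mem_nhds.1 hb),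
        (finite_range b).toFinset, ?_, by simp⟩
      simpa using (subset_convexHull ℝ _).trans hbK
  have hballF : Metric.closedBall 0 r ⊆ convexHull ℝ (F : Set (EuclideanSpace ℝ (Fin n))) :=
    subset_union_right.trans hF
  have hne : F.Nonempty := by
    rw [← Finset.coe_nonempty, ← convexHull_nonempty_iff (𝕜 := ℝ)]
    exact ⟨0, hballF (Metric.mem_closedBall_self hr.le)⟩
  have hspan : ∀ x, x ≠ 0 → ∃ v ∈ F, inner ℝ v x ≠ 0 := by
    intro x hx
    by_contra hcon
    push Not at hcon
    have hsub : convexHull ℝ (F : Set (EuclideanSpace ℝ (Fin n))) ⊆ ((ℝ ∙ x)ᗮ : Submodule ℝ _) :=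
      convexHull_min (fun v hv => Submodule.mem_orthogonal_singleton_iff_inner_left.2 (hcon v hv))
        (Submodule.convex _)
    have hmem := hsub (hballF (show (r / ‖x‖) • x ∈ Metric.closedBall 0 r by
      rw [mem_closedBall_zero_iff, norm_smul, norm_div, norm_norm, Real.norm_eq_abs, abs_of_pos hr,
        div_mul_cancel₀ _ (norm_ne_zero_iff.2 hx)]))
    have h2 := Submodule.mem_orthogonal_singleton_iff_inner_left.1 hmem
    rw [inner_smul_left, real_inner_self_eq_norm_sq] at h2
    have : 0 < r / ‖x‖ * ‖x‖ ^ 2 := by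
      have := norm_pos_iff.2 hx
      positivity
    simp only [conj_trivial] at h2
    linarith
  obtain ⟨h, hh, h1, h2⟩ := exists_isSmoothNorm_of_finset hne hspan hK hsymm hFK
  exact ⟨h, hh, (subset_union_left.trans hF).trans (convexHull_min h1 (convex_wulff h)), h2⟩

/-! ### Arbitrary symmetric convex sets -/

theorem IsOriginSymmetric.zero_mem {K : Set (EuclideanSpace ℝ (Fin n))} (hsymm : IsOriginSymmetric K)
    (hne : K.Nonempty) (hK : Convex ℝ K) : (0 : EuclideanSpace ℝ (Fin n)) ∈ K := by
  obtain ⟨x, hx⟩ := hne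
  have := hK hx (hsymm x hx) (show (0 : ℝ) ≤ 1 / 2 by norm_num) (show (0 : ℝ) ≤ 1 / 2 by norm_num)
    (by norm_num)
  simpa using this

theorem IsOriginSymmetric.zero_mem_interior {K : Set (EuclideanSpace ℝ (Fin n))}
    (hsymm : IsOriginSymmetric K) (hne : (interior K).Nonempty) (hK : Convex ℝ K) :
    (0 : EuclideanSpace ℝ (Fin n)) ∈ interior K := by
  obtain ⟨x, hx⟩ := hne
  have := hK.combo_interior_self_mem_interior hx (hsymm x (interior_subset hx))
    (show (0 : ℝ) < 1 / 2 by norm_num) (show (0 : ℝ) ≤ 1 / 2 by norm_num) (by norm_num)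
  simpa using this

/-- The boundary of a convex set is Lebesgue null. -/
theorem expMeasure_interior {u : EuclideanSpace ℝ (Fin n) → ℝ}
    {K : Set (EuclideanSpace ℝ (Fin n))} (hK : Convex ℝ K) :
    expMeasure u (interior K) = expMeasure u K := by
  have h0 : expMeasure u (frontier K) = 0 :=
    withDensity_absolutelyContinuous _ _ (hK.addHaar_frontier volume)
  refine le_antisymm (measure_mono interior_subset) ?_
  calc expMeasure u K ≤ expMeasure u (interior K ∪ frontier K) := measure_mono (by
        rw [← closure_eq_interior_union_frontier]; exact subset_closure)
    _ ≤ expMeasure u (interior K) + expMeasure u (frontier K) := measure_union_le _ _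
    _ = _ := by rw [h0, add_zero]

section

variable (hn : 1 ≤ n) {u : EuclideanSpace ℝ (Fin n) → ℝ} (hu : Continuous u)
  (hu_mono : ∀ s ∈ Icc (0 : ℝ) 1, ∀ x, u (s • x) ≤ u x)
include hn hu hu_mono

omit hu in
theorem ofReal_mul_rpow_le {c : ℝ} (hc : c ∈ Ioc (0 : ℝ) 1) {K S : Set (EuclideanSpace ℝ (Fin n))}
    (hS : c • K ⊆ S) :
    ENNReal.ofReal c * expMeasure u K ^ (1 / (n : ℝ)) ≤ expMeasure u S ^ (1 / (n : ℝ)) := by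
  have h1 := (ofReal_pow_mul_expMeasure_le hu_mono hc K).trans (measure_mono hS)
  have h2 := ENNReal.rpow_le_rpow h1 (show (0 : ℝ) ≤ 1 / n by positivity)
  rw [ENNReal.mul_rpow_of_nonneg _ _ (by positivity), ENNReal.ofReal_rpow_of_pos (pow_pos hc.1 n),
    one_div, Real.pow_rpow_inv_natCast hc.1.le (by omega)] at h2
  rwa [one_div]

theorem dimBM_of_nonempty_interior (h_strong : StrongDimBM u)
    {K L : Set (EuclideanSpace ℝ (Fin n))} (hK : Convex ℝ K)
    (hL : Convex ℝ L) (hKs : IsOriginSymmetric K) (hLs : IsOriginSymmetric L)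
    (hKi : (interior K).Nonempty) (hLi : (interior L).Nonempty) {t : ℝ} (ht : t ∈ Ioo (0 : ℝ) 1) :
    ENNReal.ofReal (1 - t) * expMeasure u K ^ (1 / (n : ℝ)) +
      ENNReal.ofReal t * expMeasure u L ^ (1 / (n : ℝ))
        ≤ expMeasure u ((1 - t) • K + t • L) ^ (1 / (n : ℝ)) := by
  have : IsLocallyFiniteMeasure (expMeasure u) :=
    IsLocallyFiniteMeasure.withDensity_ofReal (Real.continuous_exp.comp hu.neg)
  have hK0 := hKs.zero_mem_interior hKi hK
  have hL0 := hLs.zero_mem_interior hLi hL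
  have hn0 : (0 : ℝ) ≤ 1 / n := by positivity
  -- Working below the measures lets inner regularity supply compact subsets of the interiors,
  -- without assuming the sets bounded or of finite measure.
  have key : ∀ a < expMeasure u K, ∀ b < expMeasure u L,
      ENNReal.ofReal (1 - t) * a ^ (1 / (n : ℝ)) + ENNReal.ofReal t * b ^ (1 / (n : ℝ))
        ≤ expMeasure u ((1 - t) • K + t • L) ^ (1 / (n : ℝ)) := by
    intro a ha b hb
    rw [← expMeasure_interior hK] at ha
    rw [← expMeasure_interior hL] at hb
    obtain ⟨Q₁, hQ₁, hQ₁c, ha'⟩ := isOpen_interior.exists_lt_isCompact ha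
    obtain ⟨Q₂, hQ₂, hQ₂c, hb'⟩ := isOpen_interior.exists_lt_isCompact hb
    obtain ⟨h₁, hh₁, hQh₁, hhK⟩ := exists_isSmoothNorm_between hK hKs hK0 hQ₁c hQ₁
    obtain ⟨h₂, hh₂, hQh₂, hhL⟩ := exists_isSmoothNorm_between hL hLs hL0 hQ₂c hQ₂
    have hcast : ∀ {h : EuclideanSpace ℝ (Fin n) → ℝ}, IsSmoothNorm h →
        expMeasure u (wulff h) ^ (1 / (n : ℝ)) =
          ENNReal.ofReal ((expMeasure u).real (wulff h) ^ (1 / (n : ℝ))) := fun hh => by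
      rw [← ENNReal.ofReal_rpow_of_nonneg measureReal_nonneg hn0, ofReal_measureReal
        (expMeasure_lt_top hu hh.isCompact_wulff).ne]
    have hmain := le_measure_interp_rpow hh₁ hh₂ hn hu hu_mono h_strong ht
    have ht1 : 0 ≤ 1 - t := by linarith [ht.2]
    calc ENNReal.ofReal (1 - t) * a ^ (1 / (n : ℝ)) + ENNReal.ofReal t * b ^ (1 / (n : ℝ))
        ≤ ENNReal.ofReal (1 - t) * expMeasure u (wulff h₁) ^ (1 / (n : ℝ)) +
          ENNReal.ofReal t * expMeasure u (wulff h₂) ^ (1 / (n : ℝ)) := by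
          gcongr
          · exact ha'.le.trans (measure_mono hQh₁)
          · exact hb'.le.trans (measure_mono hQh₂)
      _ ≤ expMeasure u (wulff (interp h₁ h₂ t)) ^ (1 / (n : ℝ)) := by
          rw [hcast hh₁, hcast hh₂, hcast (hh₁.interp hh₂ ht), ← ENNReal.ofReal_mul ht1,
            ← ENNReal.ofReal_mul ht.1.le, ← ENNReal.ofReal_add (by positivity)
              (mul_nonneg ht.1.le (by positivity))]
          exact ENNReal.ofReal_le_ofReal hmain
      _ ≤ _ := by
          gcongr
          exact (wulff_interp_subset hh₁ hh₂ ht).trans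
            (add_subset_add (smul_set_mono hhK) (smul_set_mono hhL))
  have hpos : ∀ {S : Set (EuclideanSpace ℝ (Fin n))},
      (0 : EuclideanSpace ℝ (Fin n)) ∈ interior S → (𝓝[<] (expMeasure u S)).NeBot := fun hS =>
    nhdsLT_neBot_of_exists_lt ⟨0, expMeasure_pos hu (mem_interior_iff_mem_nhds.1 hS)⟩
  have hlim : ∀ (c : ℝ) (m : ENNReal), Tendsto (fun a : ENNReal =>
      ENNReal.ofReal c * a ^ (1 / (n : ℝ))) (𝓝[<] m)
      (𝓝 (ENNReal.ofReal c * m ^ (1 / (n : ℝ)))) := fun c m =>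
    ENNReal.Tendsto.const_mul ((ENNReal.continuous_rpow_const.tendsto m).mono_left
      nhdsWithin_le_nhds) (Or.inr ENNReal.ofReal_ne_top)
  have := hpos hK0
  have := hpos hL0
  refine le_of_tendsto ((hlim (1 - t) _).add_const _) (eventually_nhdsWithin_of_forall
    fun a ha => ?_)
  exact le_of_tendsto ((hlim t _).const_add _) (eventually_nhdsWithin_of_forall
    fun b hb => key a ha b hb)

theorem satisfiesDimBM_of_strongDimBM (h_strong : StrongDimBM u) :
    SatisfiesDimBM (expMeasure u) := by
  intro K L hKne hLne hK hL hKs hLs t ht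
  have hK0 := hKs.zero_mem hKne hK
  have hL0 := hLs.zero_mem hLne hL
  have hn0 : (0 : ℝ) < 1 / n := by
    have : (0 : ℝ) < n := by exact_mod_cast hn
    positivity
  have hsubK : (1 - t) • K ⊆ (1 - t) • K + t • L := fun x hx => by
    have := add_mem_add hx (smul_mem_smul_set (a := t) hL0)
    simpa using this
  have hsubL : t • L ⊆ (1 - t) • K + t • L := fun x hx => by
    have := add_mem_add (smul_mem_smul_set (a := 1 - t) hK0) hx
    simpa using this
  have hnull : ∀ {S : Set (EuclideanSpace ℝ (Fin n))}, Convex ℝ S → ¬(interior S).Nonempty →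
      expMeasure u S ^ (1 / (n : ℝ)) = 0 := fun hS hSi => by
    rw [← expMeasure_interior hS, not_nonempty_iff_eq_empty.1 hSi, measure_empty,
      ENNReal.zero_rpow_of_pos hn0]
  have hleK : ENNReal.ofReal (1 - t) * expMeasure u K ^ (1 / (n : ℝ)) ≤
      expMeasure u ((1 - t) • K + t • L) ^ (1 / (n : ℝ)) := by
    rcases ht.2.eq_or_lt with h | h
    · simp [h]
    · exact ofReal_mul_rpow_le hn hu_mono ⟨by linarith, by linarith [ht.1]⟩ hsubK
  have hleL : ENNReal.ofReal t * expMeasure u L ^ (1 / (n : ℝ)) ≤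
      expMeasure u ((1 - t) • K + t • L) ^ (1 / (n : ℝ)) := by
    rcases ht.1.eq_or_lt with h | h
    · simp [← h]
    · exact ofReal_mul_rpow_le hn hu_mono ⟨h, ht.2⟩ hsubL
  -- In the degenerate cases one summand vanishes, and the other is bounded by the scaling estimate,
  -- as 0 lies in both sets.
  by_cases hL' : t ≠ 0 ∧ (interior L).Nonempty
  · by_cases hK' : t ≠ 1 ∧ (interior K).Nonempty
    · exact dimBM_of_nonempty_interior hn hu hu_mono h_strong hK hL hKs hLs hK'.2 hL'.2
        ⟨lt_of_le_of_ne ht.1 hL'.1.symm, lt_of_le_of_ne ht.2 hK'.1⟩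
    · have h0 : ENNReal.ofReal (1 - t) * expMeasure u K ^ (1 / (n : ℝ)) = 0 := by
        rw [not_and_or, not_not] at hK'
        rcases hK' with h | h
        · simp [h]
        · rw [hnull hK h, mul_zero]
      rwa [h0, zero_add]
  · have h0 : ENNReal.ofReal t * expMeasure u L ^ (1 / (n : ℝ)) = 0 := by
      rw [not_and_or, not_not] at hL'
      rcases hL' with h | h
      · simp [h]
      · rw [hnull hL h, mul_zero]
    rwa [h0, add_zero]

end

end DimBM

end

theorem mainTheorem3 {n : ℕ} (hn : 1 ≤ n) (u : EuclideanSpace ℝ (Fin n) → ℝ)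
    (hu : ContDiff ℝ 2 u) (hu_even : Function.Even u) (hu_convex : ConvexOn ℝ Set.univ u)
    (hu_hess : ∀ x v : EuclideanSpace ℝ (Fin n), v ≠ 0 → 0 < fderiv ℝ (fderiv ℝ u) x v v)
    (h_strong : DimBM.StrongDimBM u) :
    DimBM.SatisfiesDimBM (DimBM.expMeasure u) :=
  DimBM.satisfiesDimBM_of_strongDimBM hn hu.continuous
    (DimBM.smul_le_of_even_of_convexOn hu_even hu_convex) h_strong
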